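/- Let $\mathcal X$ be a metric space with its Borel $\sigma$-algebra and let $\rho$ be a probability measure on $\mathcal X\times\mathbb R$, the law of $(X,Y)$, whose marginal $\rho_X$ on $\mathcal X$ is concentrated on a separable subset of $\mathcal X$ (automatic if $\mathcal X$ is separable). Consider the regression model $Y=f^*(X)+\epsilon$ with $\mathbf E(\epsilon\mid X)=0$ and let $M>0$. Assume that the model is *MEE admissible*: $f^*$ is measurable with $|f^*|\le M$; for each $x\in\mathcal X$ the noise $\epsilon$ has, given $X=x$, a probability density $p_{\epsilon|X=x}$ (jointly measurable in $x$ and its argument), and these densities are bounded by a constant independent of $x$; and the Rényi entropy $\mathscr R(f)=-\log\int_{\mathbb R}p_E(e)^2\,de$, where $p_E$ is the density of $E=Y-f(X)$, attains its minimum over all measurable $f:\mathcal X\to\mathbb R$. Let $\mathcal H$ be an *MEE admissible* hypothesis space: a set of continuous functions on $\mathcal X$ with $|f|\le M$ for all $f\in\mathcal H$, containing $f^*$ and some minimizer of $\mathscr R$, and such that $\log\mathcal N_2(\mathcal H,\varepsilon)\le c\,\varepsilon^{-s}$ for all $\varepsilon>0$, with some $c>0$ and $0<s<2$. Here $\mathcal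 N_2(\mathcal H,\varepsilon)$ is the supremum over $n\ge1$ and $x\in\mathcal X^n$ of the minimal number of balls of radius $\varepsilon$, for the metric $d_2(a,b)=(\frac1n\sum_i|a_i-b_i|^2)^{1/2}$ on $\mathbb R^n$, that cover $\{(f(x_i))_{i=1}^n: f\in\mathcal H\}$. Assume that $\rho$ belongs to the noise class $\mathcal P_2$: there is $\widetilde M>0$ such that for every $x\in\mathcal X$ the density $p_{\epsilon|X=x}$ is even and supported in $[-\widetilde M,\widetilde M]$. Let $G_h(t)=\frac1{\sqrt{2\pi}h}e^{-t^2/(2h^2)}$ and $$\mathcal E_h(f)=-\iint G_h\big((y-f(x))-(y'-f(x'))\big)\,d\rho(x,y)\,d\rho(x',y').$$ For a sample $\mathbf z=((x_i,y_i))_{i=1}^n$ drawn from $\rho^n$, $n\ge1$, let $f_{\mathbf z}$ be a minimizer over $f\in\mathcal H$ of the empirical Rényi entropy $-\log\big(\frac1{n^2}\sum_{i,j=1}^nG_h(e_i-e_j)\big)$, $e_i=y_i-f(x_i)$. Then for every fixed $h>h_{\rho,\mathcal H}:=4M+2\widetilde M$: 1. for every constant $b\in\mathbb R$, $f^*+b$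 minimizes $\mathcal E_h$ over all measurable functions $f:\mathcal X\to\mathbb R$; 2. with $\mathbf E_x$ the expectation under $\rho_X$, $f_{\mathbf z}+\mathbf E_x(f^*-f_{\mathbf z})$ converges to $f^*$ in probability as $n\to\infty$: for every $\varepsilon>0$, $\ \mathbf P\big(\|f_{\mathbf z}+\mathbf E_x(f^*-f_{\mathbf z})-f^*\|_{L^2_{\rho_X}}^2>\varepsilon\big)\to0$; 3. there is a constant $C>0$, independent of $n$, $\delta$ and the choice of the minimizers $f_{\mathbf z}$, such that for all $n\ge1$ and $0<\delta<1$, with probability at least $1-\delta$, $$\|f_{\mathbf z}+\mathbf E_x(f^*-f_{\mathbf z})-f^*\|_{L^2_{\rho_X}}^2\le C\sqrt{\log(2/\delta)}\;n^{-1/2}.$$ (If the events in 2 and 3 are not measurable, the probability of the unfavourable event is understood as an outer probability.) -/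

import Mathlib

open MeasureTheory ProbabilityTheory Filter Topology Set
open scoped NNReal ENNReal

noncomputable section

namespace MEE

variable {X : Type*}

/-- The Gaussian kernel `G_h(t) = exp (-t² / (2 h²)) / (√(2π) h)` with bandwidth `h`. -/
def gaussKernel (h t : ℝ) : ℝ :=
  1 / (√(2 * Real.pi) * h) * Real.exp (-(t ^ 2 / (2 * h ^ 2)))

/-- The Rényi entropy of order 2 of the error variable `E = Y - f(X)`, that is
`-log ∫ p_E(e)² de`, where `p_E` is the Lebesgue density of `E` and `(X, Y)` has law `ρ`. -/
def renyiEntropy [MeasurableSpace X] (ρ : Measure (X × ℝ)) (f : X → ℝ) : ℝ :=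
  -Real.log (∫ e : ℝ, (pdf (fun z : X × ℝ => z.2 - f z.1) ρ volume e).toReal ^ 2)

/-- `f` is a measurable function that minimizes the Rényi entropy over all measurable functions. -/
def IsRenyiMinimizer [MeasurableSpace X] (ρ : Measure (X × ℝ)) (f : X → ℝ) : Prop :=
  Measurable f ∧ ∀ g : X → ℝ, Measurable g → renyiEntropy ρ f ≤ renyiEntropy ρ g

/-- The empirical Rényi entropy of `f` on a sample `z` of size `n`, obtained by plugging in the
kernel density estimator with bandwidth `h`: with `e_i = y_i - f(x_i)` it is
`-log (n⁻² ∑_{i,j} G_h(e_i - e_j))`. -/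
def empiricalRenyi (h : ℝ) {n : ℕ} (z : Fin n → X × ℝ) (f : X → ℝ) : ℝ :=
  -Real.log (1 / (n : ℝ) ^ 2 * ∑ i : Fin n, ∑ j : Fin n,
    gaussKernel h (((z i).2 - f (z i).1) - ((z j).2 - f (z j).1)))

/-- `f` is an output of the MEE algorithm with bandwidth `h` over the hypothesis space `H` on the
sample `z`: it minimizes the empirical Rényi entropy over `H`. -/
def IsMEEOutput (H : Set (X → ℝ)) (h : ℝ) {n : ℕ} (z : Fin n → X × ℝ) (f : X → ℝ) : Prop :=
  f ∈ H ∧ ∀ g ∈ H, empiricalRenyi h z f ≤ empiricalRenyi h z g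

/-- The information error
`E_h(f) = -∫∫ G_h((y - f(x)) - (y' - f(x'))) dρ(x, y) dρ(x', y')`. -/
def informationError [MeasurableSpace X] (ρ : Measure (X × ℝ)) (h : ℝ) (f : X → ℝ) : ℝ :=
  -∫ z : X × ℝ, ∫ z' : X × ℝ,
    gaussKernel h ((z.2 - f z.1) - (z'.2 - f z'.1)) ∂ρ ∂ρ

/-- `‖f + E_x(f* - f) - f*‖²` in `L²(μ)`, where `E_x` is the expectation under `μ`. -/
def adjustedErrorSq [MeasurableSpace X] (μ : Measure X) (fstar f : X → ℝ) : ℝ :=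
  ∫ x, (f x + (∫ u, (fstar u - f u) ∂μ) - fstar x) ^ 2 ∂μ

/-- The `ℓ²`-norm empirical covering number of `H` at scale `ε`: the supremum over all `n ≥ 1` and
all `x ∈ Xⁿ` of the covering number of `{(f(x_i))_i : f ∈ H}` for the normalized metric
`d₂(a, b) = (n⁻¹ ∑ |a_i - b_i|²)^{1/2}`. Since `d₂(a, b) ≤ ε` means that the Euclidean distance of
`a` and `b` is at most `ε √n`, this is the Euclidean covering number at radius `ε √n`. -/
def empiricalCoveringNumber (H : Set (X → ℝ)) (ε : ℝ≥0) : ℕ∞ :=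
  ⨆ (n : ℕ) (_ : 1 ≤ n) (x : Fin n → X),
    Metric.externalCoveringNumber (ε * NNReal.sqrt n)
      ((fun f : X → ℝ => (WithLp.toLp 2 (fun i => f (x i)) : EuclideanSpace ℝ (Fin n))) '' H)

/-- `p x` is the density of the noise `ε = Y - f*(X)` given `X = x`, that is, the joint law of
`(X, ε)` has density `p` with respect to (law of `X`) ⊗ (Lebesgue measure). -/
structure IsNoiseDensity [MeasurableSpace X] (ρ : Measure (X × ℝ)) (fstar : X → ℝ)
    (p : X → ℝ → ℝ) : Prop where
  measurable : Measurable (Function.uncurry p)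
  nonneg : ∀ x t, 0 ≤ p x t
  integrable : ∀ x, Integrable (p x)
  integral_eq_one : ∀ x, ∫ t, p x t = 1
  joint_law : ρ.map (fun z : X × ℝ => (z.1, z.2 - fstar z.1)) =
    (ρ.fst.prod volume).withDensity (fun w => ENNReal.ofReal (p w.1 w.2))

/-- The regression model `Y = f*(X) + ε`, `E(ε | X) = 0`, with conditional noise density `p`, is
MEE admissible with bound `M` on the regression function. -/
structure ModelAdmissible [MeasurableSpace X] (ρ : Measure (X × ℝ)) (fstar : X → ℝ)
    (p : X → ℝ → ℝ) (M : ℝ) : Prop where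
  measurable_fstar : Measurable fstar
  density : IsNoiseDensity ρ fstar p
  integrable_noise : ∀ x, Integrable (fun t => t * p x t)
  noise_mean_zero : ∀ x, ∫ t, t * p x t = 0
  density_bounded : ∃ Mp : ℝ, ∀ x t, p x t ≤ Mp
  fstar_bounded : ∀ x, |fstar x| ≤ M
  exists_minimizer : ∃ fR, IsRenyiMinimizer ρ fR

/-- The hypothesis space `H` (a set of continuous functions) is MEE admissible, with uniform
bound `M`. -/
structure HypothesisAdmissible [TopologicalSpace X] [MeasurableSpace X] (ρ : Measure (X × ℝ))
    (fstar : X → ℝ) (H : Set (X → ℝ)) (M : ℝ) : Prop where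
  continuous : ∀ f ∈ H, Continuous f
  bounded : ∀ f ∈ H, ∀ x, |f x| ≤ M
  covering : ∃ c s : ℝ, 0 < c ∧ 0 < s ∧ s < 2 ∧ ∀ ε : ℝ≥0, 0 < ε →
    empiricalCoveringNumber H ε ≠ ⊤ ∧
      Real.log ((empiricalCoveringNumber H ε).toNat : ℝ) ≤ c * (ε : ℝ) ^ (-s)
  minimizer_mem : ∃ fR ∈ H, IsRenyiMinimizer ρ fR
  fstar_mem : fstar ∈ H

/-- The noise class `P₂` with explicit support bound `Mt > 0`: every conditional noise density is
even and supported in `[-Mt, Mt]`. -/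
def SymmetricBoundedNoise (p : X → ℝ → ℝ) (Mt : ℝ) : Prop :=
  0 < Mt ∧ (∀ x, Function.Even (p x)) ∧ ∀ x, Function.support (p x) ⊆ Icc (-Mt) Mt

end MEE

end

/-!
Conditionally on `X` the noise is symmetric, so `ρ` is invariant under the reflection
`y ↦ 2 f*(x) - y` and `E_h(f) = E_h(2 f* - f)`. Writing `d` for the increment of `f - f*` between
two observations and `u` for the difference of their noises, `2 (E_h(f) - E_h(f*))` is therefore the
mean of `2 G_h(u) - G_h(u - d) - G_h(u + d)`. Since `G_h` is concave on `[-h, h]` and `|u| < h`,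
this is nonnegative, and at least a multiple of `d²` when `d` is bounded; averaging `d²` over
independent pairs gives twice the variance of `f(X) - f*(X)`, which is the adjusted error.

It remains to bound the excess `E_h(f_z) - E_h(f*)` by a uniform deviation of the empirical
information potential. Freezing one of the two observations turns this V-statistic into a sample
mean of `G_h(y - f(x) - a)` with a real parameter `a` in a bounded interval, which adds only a
logarithmic term to the entropy of `H`. An independent copy of the sample and random signs reduce
the exponential moments of the supremum of these centred means to Rademacher sums, and chaining
bounds the latter at the scale `n^{-1/2}` because the entropy exponent is below `2`. All functions
being continuous, separability reduces arbitrary families to finite ones.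
-/

namespace MEE

open scoped BigOperators Pointwise

section Rademacher

variable {n : ℕ}

/-- The mean of `v` with random signs, `n⁻¹ ∑ σᵢ vᵢ`. The supremum of `signedMean σ` over a set of
vectors, averaged over `σ`, is the Rademacher complexity of the set. -/
noncomputable def signedMean (σ : Fin n → ℤˣ) (v : Fin n → ℝ) : ℝ :=
  (∑ i, σ i • v i) / n

lemma signedMean_add (σ : Fin n → ℤˣ) (v w : Fin n → ℝ) :
    signedMean σ (v + w) = signedMean σ v + signedMean σ w := by
  simp only [signedMean, Pi.add_apply, smul_add, Finset.sum_add_distrib, add_div]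

lemma signedMean_neg (σ : Fin n → ℤˣ) (v : Fin n → ℝ) :
    signedMean σ (-v) = -signedMean σ v := by
  simp only [signedMean, Pi.neg_apply, smul_neg, Finset.sum_neg_distrib, neg_div]

lemma signedMean_sub (σ : Fin n → ℤˣ) (v w : Fin n → ℝ) :
    signedMean σ (v - w) = signedMean σ v - signedMean σ w := by
  rw [sub_eq_add_neg, signedMean_add, signedMean_neg, sub_eq_add_neg]

lemma neg_signedMean (σ : Fin n → ℤˣ) (v : Fin n → ℝ) :
    signedMean (-σ) v = -signedMean σ v := by
  simp only [signedMean, Pi.neg_apply, Units.neg_smul, Finset.sum_neg_distrib, neg_div]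

lemma units_smul_sq (u : ℤˣ) (x : ℝ) : (u • x) ^ 2 = x ^ 2 := by
  rcases Int.units_eq_one_or u with rfl | rfl <;> simp

lemma signedMean_le_of_sum_sq_le (σ : Fin n → ℤˣ) {v : Fin n → ℝ} {d : ℝ} (hd : 0 ≤ d)
    (hv : ∑ i, v i ^ 2 ≤ n * d ^ 2) : signedMean σ v ≤ d := by
  have cauchy_schwarz : (∑ i, σ i • v i) ^ 2 ≤ n * ∑ i, (σ i • v i) ^ 2 := by
    simpa using sq_sum_le_card_mul_sum_sq (s := Finset.univ) (f := fun i => σ i • v i)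
  simp only [units_smul_sq] at cauchy_schwarz
  refine div_le_of_le_mul₀ (by positivity) hd (le_of_sq_le_sq ?_ (by positivity))
  nlinarith [n.cast_nonneg (α := ℝ)]

lemma expect_exp_sum_units_smul {ι : Type*} [Fintype ι] [DecidableEq ι] (v : ι → ℝ) :
    𝔼 σ : ι → ℤˣ, Real.exp (∑ i, σ i • v i) = ∏ i, Real.cosh (v i) := by
  have sum_units (x : ℝ) : ∑ u : ℤˣ, Real.exp (u • x) = 2 * Real.cosh x := by
    simp [UnitsInt.univ, Real.cosh_eq, mul_div_cancel₀]
  simp only [Fintype.expect_eq_sum_div_card, Real.exp_sum]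
  rw [← Fintype.prod_sum fun i (u : ℤˣ) => Real.exp (u • v i)]
  simp only [sum_units, Finset.prod_mul_distrib, Finset.prod_const, Finset.card_univ,
    Fintype.card_pi, Fintype.card_units_int, Nat.cast_pow, Nat.cast_ofNat]
  exact mul_div_cancel_left₀ _ (by positivity)

lemma expect_exp_signedMean_le (t : ℝ) (v : Fin n → ℝ) :
    𝔼 σ, Real.exp (t * signedMean σ v) ≤ Real.exp ((t / n) ^ 2 * (∑ i, v i ^ 2) / 2) :=
  calc 𝔼 σ, Real.exp (t * signedMean σ v)
    _ = 𝔼 σ : Fin n → ℤˣ, Real.exp (∑ i, σ i • (t / n * v i)) := by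
        simp only [signedMean, Finset.sum_div, Finset.mul_sum, Units.smul_def, zsmul_eq_mul]
        refine Finset.expect_congr rfl fun σ _ => congrArg _ (Finset.sum_congr rfl fun i _ => ?_)
        ring
    _ = ∏ i, Real.cosh (t / n * v i) := expect_exp_sum_units_smul _
    _ ≤ ∏ i, Real.exp ((t / n * v i) ^ 2 / 2) :=
        Finset.prod_le_prod (fun i _ => (Real.cosh_pos _).le) fun i _ => Real.cosh_le_exp_half_sq _
    _ = Real.exp ((t / n) ^ 2 * (∑ i, v i ^ 2) / 2) := by
        simp only [← Real.exp_sum, mul_pow, Finset.mul_sum, Finset.sum_div]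

lemma expect_exp_le_of_expect_exp_mul_le {α : Type*} [Fintype α] [Nonempty α] {f : α → ℝ}
    {θ b : ℝ} (hθ : 1 ≤ θ) (hf : 𝔼 a, Real.exp (θ * f a) ≤ Real.exp (θ * b)) :
    𝔼 a, Real.exp (f a) ≤ Real.exp b := by
  have power_mean : (𝔼 a, Real.exp (f a)) ^ θ ≤ 𝔼 a, Real.exp (θ * f a) := by
    have := Real.rpow_arith_mean_le_arith_mean_rpow Finset.univ
      (fun _ : α => (Fintype.card α : ℝ)⁻¹) (fun a => Real.exp (f a)) (fun _ _ => by positivity)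
      (by simp) (fun _ _ => by positivity) hθ
    simpa only [← Real.exp_mul, inv_mul_eq_div, ← Finset.sum_div,
      ← Fintype.expect_eq_sum_div_card, mul_comm θ] using this
  have hθ0 : 0 < θ := by linarith
  rw [← Real.rpow_le_rpow_iff (Finset.expect_nonneg fun _ _ => by positivity) (by positivity) hθ0,
    ← Real.exp_mul, mul_comm b]
  exact power_mean.trans hf

/-- Raising to the power `θ` before the union bound over `exp θ` vectors costs only a factor `θ` in
the exponent. -/
lemma expect_exp_signedMean_le_of_card_image_le {D θ : ℝ} (t : ℝ) (hθ : 1 ≤ θ)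
    {v : (Fin n → ℤˣ) → Fin n → ℝ} (hv : ∀ σ, ∑ i, v σ i ^ 2 ≤ n * D)
    (hcard : ((Finset.univ.image v).card : ℝ) ≤ Real.exp θ) :
    𝔼 σ, Real.exp (t * signedMean σ (v σ)) ≤ Real.exp (1 + θ * D / 2 * (t ^ 2 / n)) := by
  refine expect_exp_le_of_expect_exp_mul_le hθ ?_
  simp only [← mul_assoc θ t]
  have single (u) (hu : u ∈ Finset.univ.image v) :
      𝔼 σ, Real.exp (θ * t * signedMean σ u) ≤ Real.exp ((θ * t) ^ 2 * D / (2 * n)) := by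
    obtain ⟨σ, -, rfl⟩ := Finset.mem_image.1 hu
    refine (expect_exp_signedMean_le _ _).trans (Real.exp_le_exp.2 ?_)
    rcases n.eq_zero_or_pos with rfl | hn
    · simp
    calc (θ * t / n) ^ 2 * (∑ i, v σ i ^ 2) / 2 ≤ (θ * t / n) ^ 2 * (n * D) / 2 := by
          gcongr; exact hv σ
      _ = (θ * t) ^ 2 * D / (2 * n) := by field_simp
  calc 𝔼 σ, Real.exp (θ * t * signedMean σ (v σ))
    _ ≤ 𝔼 σ, ∑ u ∈ Finset.univ.image v, Real.exp (θ * t * signedMean σ u) :=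
        Finset.expect_le_expect fun σ _ => Finset.single_le_sum
          (f := fun u => Real.exp (θ * t * signedMean σ u)) (fun _ _ => by positivity)
          (Finset.mem_image_of_mem v (Finset.mem_univ σ))
    _ = ∑ u ∈ Finset.univ.image v, 𝔼 σ, Real.exp (θ * t * signedMean σ u) :=
        Finset.expect_sum_comm _ _ _
    _ ≤ (Finset.univ.image v).card * Real.exp ((θ * t) ^ 2 * D / (2 * n)) := by
        simpa using Finset.sum_le_card_nsmul _ _ _ single
    _ ≤ Real.exp θ * Real.exp ((θ * t) ^ 2 * D / (2 * n)) := by gcongr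
    _ = Real.exp (θ * (1 + θ * D / 2 * (t ^ 2 / n))) := by
        rw [← Real.exp_add]
        congr 1
        ring

/-- The exponential moments of `sup_{v ∈ A} signedMean σ v` are those of a subgaussian variable
with variance proxy of order `κ / n`. An arbitrary selection `v σ ∈ A` stands for a near-maximizer,
so that no finiteness, boundedness or measurability of `A` is involved. -/
def IsRademacherSubgaussian (κ : ℝ) (A : Set (Fin n → ℝ)) : Prop :=
  ∀ v : (Fin n → ℤˣ) → Fin n → ℝ, (∀ σ, v σ ∈ A) → ∀ t : ℝ, 0 ≤ t →
    𝔼 σ, Real.exp (t * signedMean σ (v σ)) ≤ Real.exp (2 + κ * (t ^ 2 / n))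

namespace IsRademacherSubgaussian

variable {κ : ℝ} {A B : Set (Fin n → ℝ)}

lemma mono (hB : IsRademacherSubgaussian κ B) (hAB : A ⊆ B) : IsRademacherSubgaussian κ A :=
  fun v hv => hB v fun σ => hAB (hv σ)

lemma neg (hA : IsRademacherSubgaussian κ A) : IsRademacherSubgaussian κ (-A) := by
  intro v hv t ht
  refine le_trans (le_of_eq ?_) (hA (fun σ => -v (-σ)) (fun σ => hv (-σ)) t ht)
  refine Fintype.expect_equiv (Equiv.neg _) _ _ fun σ => ?_
  simp [signedMean_neg, neg_signedMean]

lemma sub (hA : IsRademacherSubgaussian κ A) (hB : IsRademacherSubgaussian κ B) :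
    IsRademacherSubgaussian (4 * κ) (A - B) := by
  intro u hu t ht
  choose v hv w hw hvw using hu
  have convexity (x y : ℝ) :
      Real.exp (x - y) ≤ 2⁻¹ * Real.exp (2 * x) + 2⁻¹ * Real.exp (2 * -y) := by
    have := convexOn_exp.2 (mem_univ (2 * x)) (mem_univ (2 * -y))
      (by norm_num : (0 : ℝ) ≤ 2⁻¹) (by norm_num : (0 : ℝ) ≤ 2⁻¹) (by norm_num)
    simp only [smul_eq_mul] at this
    refine le_trans (le_of_eq ?_) this
    ring_nf
  have bound (v : (Fin n → ℤˣ) → Fin n → ℝ) {B : Set (Fin n → ℝ)}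
      (hB : IsRademacherSubgaussian κ B) (hv : ∀ σ, v σ ∈ B) :
      𝔼 σ, Real.exp (2 * (t * signedMean σ (v σ))) ≤ Real.exp (2 + 4 * κ * (t ^ 2 / n)) := by
    have := hB v hv (2 * t) (by positivity)
    simp only [mul_assoc 2 t] at this
    exact this.trans_eq (by ring_nf)
  have hw' := bound (fun σ => -w σ) hB.neg fun σ => by simpa using hw σ
  simp only [signedMean_neg, mul_neg] at hw'
  calc 𝔼 σ, Real.exp (t * signedMean σ (u σ))
    _ ≤ 𝔼 σ, (2⁻¹ * Real.exp (2 * (t * signedMean σ (v σ))) +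
          2⁻¹ * Real.exp (-(2 * (t * signedMean σ (w σ))))) := by
        refine Finset.expect_le_expect fun σ _ => ?_
        rw [← hvw σ, signedMean_sub, mul_sub, ← mul_neg 2]
        exact convexity _ _
    _ ≤ Real.exp (2 + 4 * κ * (t ^ 2 / n)) := by
        rw [Finset.expect_add_distrib, ← Finset.mul_expect, ← Finset.mul_expect]
        linarith [bound v hA hv]

lemma expect_exp_mul_iSup_le {ι : Type*} [Finite ι] [Nonempty ι] {v : ι → Fin n → ℝ}
    (hv : IsRademacherSubgaussian κ (range v)) {t : ℝ} (ht : 0 ≤ t) :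
    𝔼 σ, Real.exp (t * ⨆ i, signedMean σ (v i)) ≤ Real.exp (2 + κ * (t ^ 2 / n)) := by
  choose imax himax using fun σ : Fin n → ℤˣ =>
    exists_eq_ciSup_of_finite (f := fun i => signedMean σ (v i))
  simpa only [himax] using hv (fun σ => v (imax σ)) (fun σ => mem_range_self _) t ht

end IsRademacherSubgaussian

end Rademacher

section Chaining

variable {n : ℕ}

/-- `A` is covered by at most `N` balls of radius `r` for the normalized metric
`d₂(a, b) = (n⁻¹ ∑ |a_i - b_i|²)^{1/2}`. The centres need not lie in `A`. -/
def HasCover (N r : ℝ) (A : Set (Fin n → ℝ)) : Prop :=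
  ∃ C : Finset (Fin n → ℝ), (C.card : ℝ) ≤ N ∧
    ∀ v ∈ A, ∃ u ∈ C, ∑ i, (v i - u i) ^ 2 ≤ n * r ^ 2

lemma sum_sub_sq_le {ι : Type*} [Fintype ι] (u v w : ι → ℝ) :
    ∑ i, (u i - w i) ^ 2 ≤ 2 * ∑ i, (v i - u i) ^ 2 + 2 * ∑ i, (v i - w i) ^ 2 := by
  rw [Finset.mul_sum, Finset.mul_sum, ← Finset.sum_add_distrib]
  exact Finset.sum_le_sum fun i _ => by nlinarith [sq_nonneg ((v i - u i) + (v i - w i))]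

lemma card_image_sub_le {α E : Type*} [Fintype α] [DecidableEq E] [Sub E] (f g : α → E) :
    (Finset.univ.image fun a => f a - g a).card ≤
      (Finset.univ.image f).card * (Finset.univ.image g).card := by
  rw [← Finset.card_product]
  refine (Finset.card_le_card fun u hu => ?_).trans
    (Finset.card_image_le (f := fun p : E × E => p.1 - p.2))
  obtain ⟨a, -, rfl⟩ := Finset.mem_image.1 hu
  exact Finset.mem_image.2 ⟨(f a, g a), Finset.mk_mem_product
    (Finset.mem_image_of_mem f (Finset.mem_univ a))
    (Finset.mem_image_of_mem g (Finset.mem_univ a)), rfl⟩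

lemma exp_sum_range_le {q : ℝ} (hq0 : 0 < q) (hq1 : q < 1) (x : ℕ → ℝ) (K : ℕ) :
    Real.exp (∑ k ∈ Finset.range K, x k) ≤ q ^ K + ∑ k ∈ Finset.range K,
      (1 - q) * q ^ k * Real.exp (x k / ((1 - q) * q ^ k)) := by
  have weight_pos (k : ℕ) : 0 < (1 - q) * q ^ k := mul_pos (by linarith) (by positivity)
  have sum_weights : q ^ K + ∑ k ∈ Finset.range K, (1 - q) * q ^ k = 1 := by
    rw [← Finset.mul_sum, mul_comm, geom_sum_mul_neg]
    ring
  have := convexOn_exp.map_add_sum_le (t := Finset.range K) (w := fun k => (1 - q) * q ^ k)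
    (p := fun k => x k / ((1 - q) * q ^ k)) (v := q ^ K) (q := 0) (fun k _ => (weight_pos k).le)
    sum_weights (fun _ _ => mem_univ _) (by positivity) (mem_univ _)
  simpa only [smul_eq_mul, mul_zero, zero_add, Real.exp_zero, mul_one,
    mul_div_cancel₀ _ (weight_pos _).ne'] using this

lemma expect_exp_sum_range_le {α : Type*} [Fintype α] [Nonempty α] {q b : ℝ} (hq0 : 0 < q)
    (hq1 : q < 1) (hb : 0 ≤ b) {x : ℕ → α → ℝ}
    (hx : ∀ k, 𝔼 a, Real.exp (x k a / ((1 - q) * q ^ k)) ≤ Real.exp b) (K : ℕ) :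
    𝔼 a, Real.exp (∑ k ∈ Finset.range K, x k a) ≤ Real.exp b :=
  calc 𝔼 a, Real.exp (∑ k ∈ Finset.range K, x k a)
    _ ≤ 𝔼 a, (q ^ K + ∑ k ∈ Finset.range K,
          (1 - q) * q ^ k * Real.exp (x k a / ((1 - q) * q ^ k))) :=
        Finset.expect_le_expect fun a _ => exp_sum_range_le hq0 hq1 (fun k => x k a) K
    _ = q ^ K + ∑ k ∈ Finset.range K,
          (1 - q) * q ^ k * 𝔼 a, Real.exp (x k a / ((1 - q) * q ^ k)) := by
        simp only [Finset.expect_add_distrib, Fintype.expect_const, Finset.expect_sum_comm,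
          Finset.mul_expect]
    _ ≤ q ^ K * Real.exp b + ∑ k ∈ Finset.range K, (1 - q) * q ^ k * Real.exp b := by
        have : 0 ≤ 1 - q := by linarith
        gcongr with k
        · exact le_mul_of_one_le_right (by positivity) (Real.one_le_exp hb)
        · exact hx k
    _ = Real.exp b := by
        rw [← Finset.sum_mul, ← add_mul, ← Finset.mul_sum, mul_comm (1 - q), geom_sum_mul_neg]
        ring

lemma exists_chain {α : Type*} [Fintype α] {L c τ : ℝ} (hc : 0 ≤ c) {A : Set (Fin n → ℝ)}
    (hA : ∀ v ∈ A, ∑ i, v i ^ 2 ≤ n * L ^ 2)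
    (hcover : ∀ k : ℕ, HasCover (Real.exp (c * τ ^ k)) (L / 2 ^ k) A)
    {v : α → Fin n → ℝ} (hv : ∀ a, v a ∈ A) :
    ∃ π : ℕ → α → Fin n → ℝ, (∀ a, π 0 a = 0) ∧
      (∀ k, ((Finset.univ.image (π k)).card : ℝ) ≤ Real.exp (c * τ ^ k)) ∧
      ∀ k a, ∑ i, (v a i - π k a i) ^ 2 ≤ n * (L / 2 ^ k) ^ 2 := by
  choose C hcard hC using hcover
  choose! π hmem hdist using hC
  refine ⟨fun k a => if k = 0 then 0 else π k (v a), fun a => if_pos rfl, fun k => ?_,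
    fun k a => ?_⟩
  · rcases eq_or_ne k 0 with rfl | hk
    · have : ((Finset.univ.image fun _ : α => (0 : Fin n → ℝ)).card : ℝ) ≤ 1 := by
        exact_mod_cast (Finset.card_le_card (Finset.image_subset_iff.2 fun _ _ =>
          Finset.mem_singleton_self 0)).trans_eq (Finset.card_singleton _)
      simpa only [↓reduceIte] using this.trans (Real.one_le_exp (by simpa using hc))
    · simp only [if_neg hk]
      refine le_trans ?_ (hcard k)
      exact_mod_cast Finset.card_le_card (Finset.image_subset_iff.2 fun a _ => hmem k _ (hv a))
  · rcases eq_or_ne k 0 with rfl | hk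
    · simpa using hA _ (hv a)
    · simpa only [if_neg hk] using hdist k _ (hv a)

lemma card_image_chain_step_le {α E : Type*} [Fintype α] [DecidableEq E] [Sub E] {c τ : ℝ}
    (hc : 0 ≤ c) (hτ : 0 ≤ τ) (hτ4 : τ ≤ 4) {π : ℕ → α → E}
    (hcard : ∀ k, ((Finset.univ.image (π k)).card : ℝ) ≤ Real.exp (c * τ ^ k)) (k : ℕ) :
    ((Finset.univ.image fun a => π (k + 1) a - π k a).card : ℝ) ≤ Real.exp (5 * c * τ ^ k) :=
  calc ((Finset.univ.image fun a => π (k + 1) a - π k a).card : ℝ)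
    _ ≤ (Finset.univ.image (π (k + 1))).card * (Finset.univ.image (π k)).card := by
        exact_mod_cast card_image_sub_le _ _
    _ ≤ Real.exp (c * τ ^ (k + 1)) * Real.exp (c * τ ^ k) := by gcongr <;> exact hcard _
    _ ≤ Real.exp (5 * c * τ ^ k) := by
        rw [← Real.exp_add, Real.exp_le_exp, pow_succ]
        have : c * (τ ^ k * τ) ≤ c * (τ ^ k * 4) := by gcongr
        linarith

/-- At level `k` there are `exp (O (τ ^ k))` increments of squared `d₂`-length `O (4 ^ (-k))`. The
weights `(√τ / 2) ^ k` are chosen so that the powers of `τ` and of `4` cancel. -/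
lemma expect_exp_signedMean_chain_step_le {L c τ : ℝ} (t : ℝ) (hc : 0 ≤ c) (hτ : 1 ≤ τ)
    (hτ4 : τ < 4) {v : (Fin n → ℤˣ) → Fin n → ℝ} {π : ℕ → (Fin n → ℤˣ) → Fin n → ℝ}
    (hcard : ∀ k, ((Finset.univ.image (π k)).card : ℝ) ≤ Real.exp (c * τ ^ k))
    (hdist : ∀ k σ, ∑ i, (v σ i - π k σ i) ^ 2 ≤ n * (L / 2 ^ k) ^ 2) (k : ℕ) :
    𝔼 σ, Real.exp (t * signedMean σ (π (k + 1) σ - π k σ) / ((1 - √τ / 2) * (√τ / 2) ^ k)) ≤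
      Real.exp (1 + 5 / 4 * (1 + 5 * c) * L ^ 2 / (1 - √τ / 2) ^ 2 * (t ^ 2 / n)) := by
  have hτk : 1 ≤ τ ^ k := one_le_pow₀ hτ
  have hlength (σ) : ∑ i, (π (k + 1) σ - π k σ) i ^ 2 ≤ n * (5 / 2 * (L / 2 ^ k) ^ 2) := by
    have hsub := sum_sub_sq_le (π (k + 1) σ) (v σ) (π k σ)
    have hfine := hdist (k + 1) σ
    rw [pow_succ (2 : ℝ), ← div_div, div_pow _ (2 : ℝ)] at hfine
    simp only [Pi.sub_apply]
    linarith [hdist k σ]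
  have hcard_step : ((Finset.univ.image fun σ => π (k + 1) σ - π k σ).card : ℝ) ≤
      Real.exp ((1 + 5 * c) * τ ^ k) :=
    (card_image_chain_step_le hc (by linarith) hτ4.le hcard k).trans
      (Real.exp_le_exp.2 (by linarith))
  have hθ : 1 ≤ (1 + 5 * c) * τ ^ k := by nlinarith
  have := expect_exp_signedMean_le_of_card_image_le (t / ((1 - √τ / 2) * (√τ / 2) ^ k)) hθ
    hlength hcard_step
  simp only [div_mul_eq_mul_div] at this
  refine this.trans_eq ?_
  congr 2
  have hweight : ((√τ / 2) ^ k) ^ 2 = τ ^ k / (2 ^ k) ^ 2 := by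
    rw [div_pow, div_pow, ← pow_mul, mul_comm k, pow_mul, Real.sq_sqrt (by linarith)]
  have : 1 - √τ / 2 ≠ 0 := by
    have : √τ < 2 := (Real.sqrt_lt' two_pos).2 (by linarith)
    linarith
  rw [div_pow t, mul_pow (1 - √τ / 2), hweight]
  field_simp
  ring

theorem isRademacherSubgaussian_of_hasCover {L c τ : ℝ} (hL : 0 ≤ L) (hc : 0 ≤ c) (hτ : 1 ≤ τ)
    (hτ4 : τ < 4) {A : Set (Fin n → ℝ)} (hA : ∀ v ∈ A, ∑ i, v i ^ 2 ≤ n * L ^ 2)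
    (hcover : ∀ k : ℕ, HasCover (Real.exp (c * τ ^ k)) (L / 2 ^ k) A) :
    IsRademacherSubgaussian (5 / 4 * (1 + 5 * c) * L ^ 2 / (1 - √τ / 2) ^ 2) A := by
  intro v hv t ht
  set κ := 5 / 4 * (1 + 5 * c) * L ^ 2 / (1 - √τ / 2) ^ 2
  have : 0 ≤ κ := by positivity
  obtain ⟨π, hπ0, hcard, hdist⟩ := exists_chain hc hA hcover hv
  obtain ⟨K, hK⟩ : ∃ K : ℕ, t * (L / 2 ^ K) ≤ 1 := by
    obtain ⟨K, hK⟩ := pow_unbounded_of_one_lt (t * L) one_lt_two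
    exact ⟨K, by rw [mul_div_assoc', div_le_one (by positivity)]; exact hK.le⟩
  have telescope (σ) : signedMean σ (v σ) = signedMean σ (v σ - π K σ) +
      ∑ k ∈ Finset.range K, signedMean σ (π (k + 1) σ - π k σ) := by
    simp only [signedMean_sub]
    rw [Finset.sum_range_sub fun k => signedMean σ (π k σ), hπ0]
    simp [signedMean]
  have hrest (σ) : t * signedMean σ (v σ - π K σ) ≤ 1 :=
    (mul_le_mul_of_nonneg_left
      (signedMean_le_of_sum_sq_le σ (by positivity) (hdist K σ)) ht).trans hK
  have hsum : 𝔼 σ, Real.exp (∑ k ∈ Finset.range K, t * signedMean σ (π (k + 1) σ - π k σ)) ≤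
      Real.exp (1 + κ * (t ^ 2 / n)) := by
    have : √τ < 2 := (Real.sqrt_lt' two_pos).2 (by linarith)
    exact expect_exp_sum_range_le (by positivity) (by linarith) (by positivity)
      (expect_exp_signedMean_chain_step_le t hc hτ hτ4 hcard hdist) K
  calc 𝔼 σ, Real.exp (t * signedMean σ (v σ))
    _ ≤ 𝔼 σ, Real.exp 1 *
          Real.exp (∑ k ∈ Finset.range K, t * signedMean σ (π (k + 1) σ - π k σ)) := by
        refine Finset.expect_le_expect fun σ _ => ?_
        rw [← Real.exp_add, Real.exp_le_exp, telescope, mul_add, Finset.mul_sum]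
        gcongr
        exact hrest σ
    _ ≤ Real.exp 1 * Real.exp (1 + κ * (t ^ 2 / n)) := by
        rw [← Finset.mul_expect]
        gcongr
    _ = Real.exp (2 + κ * (t ^ 2 / n)) := by
        rw [← Real.exp_add]
        ring_nf

end Chaining

section GhostSample

variable {Ω ι : Type*} [MeasurableSpace Ω] {μ : Measure Ω}

lemma integrable_exp_mul_iSup [IsFiniteMeasure μ] [Finite ι] [Nonempty ι] {Y : ι → Ω → ℝ}
    (hY : ∀ i, Measurable (Y i)) {B t : ℝ} (hB : ∀ i ω, Y i ω ≤ B) (ht : 0 ≤ t) :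
    Integrable (fun ω => Real.exp (t * ⨆ i, Y i ω)) μ := by
  have hmeas : Measurable fun ω => Real.exp (t * ⨆ i, Y i ω) :=
    ((Measurable.iSup hY).const_mul t).exp
  refine Integrable.of_bound hmeas.aestronglyMeasurable (Real.exp (t * B)) (ae_of_all _ fun ω => ?_)
  rw [Real.norm_eq_abs, Real.abs_exp]
  gcongr
  exact ciSup_le fun i => hB i ω

lemma exp_mul_iSup_integral_le [IsProbabilityMeasure μ] [Finite ι] [Nonempty ι] {Y : ι → Ω → ℝ}
    (hY : ∀ i, Measurable (Y i)) {B t : ℝ} (hB : ∀ i ω, |Y i ω| ≤ B) (ht : 0 ≤ t) :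
    Real.exp (t * ⨆ i, ∫ ω, Y i ω ∂μ) ≤ mgf (fun ω => ⨆ i, Y i ω) μ t := by
  obtain ⟨i, hi⟩ := exists_eq_ciSup_of_finite (f := fun i => ∫ ω, Y i ω ∂μ)
  have hint : Integrable (Y i) μ :=
    Integrable.of_bound (hY i).aestronglyMeasurable B (ae_of_all _ (hB i))
  have hexp : Integrable (fun ω => Real.exp (t * Y i ω)) μ := by
    simpa using integrable_exp_mul_iSup (ι := Unit) (fun _ => hY i)
      (fun _ ω => (abs_le.1 (hB i ω)).2) ht
  calc Real.exp (t * ⨆ i, ∫ ω, Y i ω ∂μ)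
    _ = Real.exp (∫ ω, t * Y i ω ∂μ) := by rw [← hi, integral_const_mul]
    _ ≤ ∫ ω, Real.exp (t * Y i ω) ∂μ :=
        convexOn_exp.map_integral_le Real.continuous_exp.continuousOn isClosed_univ
          (ae_of_all _ fun _ => mem_univ _) (hint.const_mul t) hexp
    _ ≤ mgf (fun ω => ⨆ i, Y i ω) μ t := by
        refine integral_mono hexp
          (integrable_exp_mul_iSup hY (fun i ω => (abs_le.1 (hB i ω)).2) ht) fun ω => ?_
        dsimp only
        gcongr
        exact le_ciSup (f := fun i => Y i ω) (finite_range _).bddAbove i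

/-- Jensen's inequality in the second coordinate replaces the means by an independent copy of the
process. -/
lemma mgf_iSup_sub_integral_le [IsProbabilityMeasure μ] [Finite ι] [Nonempty ι] {Y : ι → Ω → ℝ}
    (hY : ∀ i, Measurable (Y i)) {B t : ℝ} (hB : ∀ i ω, |Y i ω| ≤ B) (ht : 0 ≤ t) :
    mgf (fun ω => ⨆ i, (Y i ω - ∫ ω', Y i ω' ∂μ)) μ t ≤
      mgf (fun w : Ω × Ω => ⨆ i, (Y i w.1 - Y i w.2)) (μ.prod μ) t := by
  have hsub (i) (ω ω' : Ω) : |Y i ω - Y i ω'| ≤ B + B :=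
    (abs_sub _ _).trans (add_le_add (hB i ω) (hB i ω'))
  have hint (i) : Integrable (Y i) μ :=
    Integrable.of_bound (hY i).aestronglyMeasurable B (ae_of_all _ (hB i))
  have hmean (i) (ω : Ω) : Y i ω - ∫ ω', Y i ω' ∂μ = ∫ ω', (Y i ω - Y i ω') ∂μ := by
    rw [integral_sub (integrable_const _) (hint i)]
    simp
  have hbound (i) (ω : Ω) : Y i ω - ∫ ω', Y i ω' ∂μ ≤ B + B := by
    rw [hmean]
    refine (le_abs_self _).trans ?_
    simpa using norm_integral_le_of_norm_le_const (μ := μ) (f := fun ω' => Y i ω - Y i ω')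
      (ae_of_all _ (hsub i ω))
  have hprod : Integrable (fun w : Ω × Ω => Real.exp (t * ⨆ i, (Y i w.1 - Y i w.2)))
      (μ.prod μ) :=
    integrable_exp_mul_iSup (fun i => by fun_prop) (fun i w => (abs_le.1 (hsub i w.1 w.2)).2) ht
  calc mgf (fun ω => ⨆ i, (Y i ω - ∫ ω', Y i ω' ∂μ)) μ t
    _ ≤ ∫ ω, ∫ ω', Real.exp (t * ⨆ i, (Y i ω - Y i ω')) ∂μ ∂μ := by
        refine integral_mono (integrable_exp_mul_iSup (fun i => by fun_prop) hbound ht)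
          hprod.integral_prod_left fun ω => ?_
        simp only [hmean]
        exact exp_mul_iSup_integral_le (fun i => by fun_prop) (fun i ω' => hsub i ω ω') ht
    _ = mgf (fun w : Ω × Ω => ⨆ i, (Y i w.1 - Y i w.2)) (μ.prod μ) t :=
        (integral_prod _ hprod).symm

lemma integral_eq_integral_expect_comp {α : Type*} [Fintype α] [Nonempty α] {T : α → Ω → Ω}
    (hT : ∀ a, MeasurePreserving (T a) μ μ) {F : Ω → ℝ} (hF : Integrable F μ) :
    ∫ ω, F ω ∂μ = ∫ ω, 𝔼 a, F (T a ω) ∂μ := by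
  have hcomp (a) : ∫ ω, F (T a ω) ∂μ = ∫ ω, F ω ∂μ := by
    have := integral_map (hT a).aemeasurable ((hT a).map_eq ▸ hF.aestronglyMeasurable)
    rwa [(hT a).map_eq, eq_comm] at this
  simp only [Fintype.expect_eq_sum_div_card]
  rw [integral_div, integral_finsetSum (f := fun a ω => F (T a ω)) _ fun a _ =>
    (hT a).integrable_comp_of_integrable hF]
  simp only [hcomp, Finset.sum_const, Finset.card_univ, nsmul_eq_mul]
  rw [mul_div_cancel_left₀ _ (by positivity)]

end GhostSample

section Symmetrization

variable {Ω ι : Type*} {n : ℕ}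

/-- The mean of `φ` over the sample `z`. -/
noncomputable def sampleMean (φ : Ω → ℝ) (z : Fin n → Ω) : ℝ :=
  (∑ i, φ (z i)) / n

lemma sampleMean_neg (φ : Ω → ℝ) (z : Fin n → Ω) : sampleMean (-φ) z = -sampleMean φ z := by
  simp only [sampleMean, Pi.neg_apply, Finset.sum_neg_distrib, neg_div]

lemma sampleMean_sub (φ ψ : Ω → ℝ) (z : Fin n → Ω) :
    sampleMean φ z - sampleMean ψ z = sampleMean (fun ω => φ ω - ψ ω) z := by
  simp only [sampleMean, ← sub_div, Finset.sum_sub_distrib]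

lemma abs_sampleMean_le (hn : n ≠ 0) {φ : Ω → ℝ} {z : Fin n → Ω} {B : ℝ}
    (hB : ∀ i, |φ (z i)| ≤ B) : |sampleMean φ z| ≤ B := by
  have hn' : (0 : ℝ) < n := by positivity
  rw [sampleMean, abs_div, Nat.abs_cast, div_le_iff₀ hn', mul_comm]
  simpa using (Finset.abs_sum_le_sum_abs _ _).trans
    (Finset.sum_le_card_nsmul Finset.univ _ B fun i _ => hB i)

/-- The exchange of the `i`-th points of a sample and its independent copy for all `i` with
`σ i = -1`. -/
def signSwap (σ : Fin n → ℤˣ) (w : (Fin n → Ω) × (Fin n → Ω)) : (Fin n → Ω) × (Fin n → Ω) :=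
  (fun i => if σ i = 1 then w.1 i else w.2 i, fun i => if σ i = 1 then w.2 i else w.1 i)

lemma sampleMean_signSwap_sub (φ : Ω → ℝ) (σ : Fin n → ℤˣ) (w : (Fin n → Ω) × (Fin n → Ω)) :
    sampleMean φ (signSwap σ w).1 - sampleMean φ (signSwap σ w).2 =
      signedMean σ (φ ∘ w.1 - φ ∘ w.2) := by
  simp only [sampleMean, signedMean, ← sub_div, ← Finset.sum_sub_distrib]
  congr 1
  refine Finset.sum_congr rfl fun i _ => ?_
  rcases Int.units_eq_one_or (σ i) with hi | hi <;> simp [signSwap, hi]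

variable [MeasurableSpace Ω] {P : Measure Ω} [IsProbabilityMeasure P]

lemma measurable_sampleMean {φ : Ω → ℝ} (hφ : Measurable φ) :
    Measurable (sampleMean φ : (Fin n → Ω) → ℝ) := by
  unfold sampleMean
  fun_prop

lemma integral_sampleMean (hn : n ≠ 0) {φ : Ω → ℝ} (hφ : Integrable φ P) :
    ∫ z, sampleMean φ z ∂(Measure.pi fun _ : Fin n => P) = ∫ ω, φ ω ∂P := by
  have heval (i : Fin n) : ∫ z, φ (z i) ∂(Measure.pi fun _ => P) = ∫ ω, φ ω ∂P :=
    integral_comp_eval (μ := fun _ : Fin n => P) hφ.aestronglyMeasurable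
  simp only [sampleMean]
  rw [integral_div, integral_finsetSum _ fun i _ => integrable_comp_eval hφ]
  simp [heval, hn]

lemma measurePreserving_signSwap (σ : Fin n → ℤˣ) :
    MeasurePreserving (signSwap σ : (Fin n → Ω) × (Fin n → Ω) → _)
      ((Measure.pi fun _ => P).prod (Measure.pi fun _ => P))
      ((Measure.pi fun _ => P).prod (Measure.pi fun _ => P)) := by
  have hpairs := measurePreserving_arrowProdEquivProdArrow Ω Ω (Fin n) (fun _ => P) fun _ => P
  have hswap : MeasurePreserving
      (fun (w : Fin n → Ω × Ω) i => if σ i = 1 then w i else (w i).swap)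
      (Measure.pi fun _ => P.prod P) (Measure.pi fun _ => P.prod P) := by
    refine measurePreserving_pi _ _
      (f := fun i (x : Ω × Ω) => if σ i = 1 then x else x.swap) fun i => ?_
    by_cases hi : σ i = 1 <;> simp only [hi, if_true, if_false]
    · exact MeasurePreserving.id _
    · exact Measure.measurePreserving_swap
  convert hpairs.comp (hswap.comp hpairs.symm) using 1
  ext w i <;> by_cases hi : σ i = 1 <;> simp [signSwap, MeasurableEquiv.arrowProdEquivProdArrow,
    Equiv.arrowProdEquivProdArrow, hi]

theorem mgf_iSup_sampleMean_sub_integral_le [Finite ι] [Nonempty ι] (hn : n ≠ 0) {g : ι → Ω → ℝ}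
    (hg : ∀ i, Measurable (g i)) {B : ℝ} (hB : ∀ i ω, |g i ω| ≤ B) {κ : ℝ}
    (hκ : ∀ z : Fin n → Ω, IsRademacherSubgaussian κ (range fun i => g i ∘ z)) {t : ℝ}
    (ht : 0 ≤ t) :
    mgf (fun z => ⨆ i, (sampleMean (g i) z - ∫ ω, g i ω ∂P)) (Measure.pi fun _ : Fin n => P) t ≤
      Real.exp (2 + 4 * κ * (t ^ 2 / n)) := by
  set Q := Measure.pi fun _ : Fin n => P
  have hint (i) : Integrable (g i) P :=
    Integrable.of_bound (hg i).aestronglyMeasurable B (ae_of_all _ (hB i))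
  have hmeas (i) : Measurable (sampleMean (g i) : (Fin n → Ω) → ℝ) := measurable_sampleMean (hg i)
  have hbound (i) (w : (Fin n → Ω) × (Fin n → Ω)) :
      sampleMean (g i) w.1 - sampleMean (g i) w.2 ≤ B + B :=
    (le_abs_self _).trans ((abs_sub _ _).trans
      (add_le_add (abs_sampleMean_le hn fun _ => hB i _) (abs_sampleMean_le hn fun _ => hB i _)))
  have hsub (w : (Fin n → Ω) × (Fin n → Ω)) :
      IsRademacherSubgaussian (4 * κ) (range fun i => g i ∘ w.1 - g i ∘ w.2) :=
    ((hκ w.1).sub (hκ w.2)).mono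
      (range_subset_iff.2 fun i => sub_mem_sub (mem_range_self i) (mem_range_self i))
  calc mgf (fun z => ⨆ i, (sampleMean (g i) z - ∫ ω, g i ω ∂P)) Q t
    _ ≤ mgf (fun w => ⨆ i, (sampleMean (g i) w.1 - sampleMean (g i) w.2)) (Q.prod Q) t := by
        simp only [← integral_sampleMean hn (hint _)]
        exact mgf_iSup_sub_integral_le hmeas (fun i _ => abs_sampleMean_le hn fun _ => hB i _) ht
    _ = ∫ w, 𝔼 σ, Real.exp (t * ⨆ i, signedMean σ (g i ∘ w.1 - g i ∘ w.2)) ∂(Q.prod Q) := by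
        simp only [← sampleMean_signSwap_sub]
        exact integral_eq_integral_expect_comp measurePreserving_signSwap
          (integrable_exp_mul_iSup (fun i => by fun_prop) hbound ht)
    _ ≤ Real.exp (2 + 4 * κ * (t ^ 2 / n)) := by
        refine (le_abs_self _).trans ?_
        simpa using norm_integral_le_of_norm_le_const (μ := Q.prod Q) (f := fun w =>
          𝔼 σ, Real.exp (t * ⨆ i, signedMean σ (g i ∘ w.1 - g i ∘ w.2))) (ae_of_all _ fun w => by
          rw [Real.norm_of_nonneg (Finset.expect_nonneg fun _ _ => by positivity)]
          exact (hsub w).expect_exp_mul_iSup_le ht)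

/-- Chernoff's bound at the optimal `t * n / (8 * κ)`. -/
theorem measure_exists_lt_sampleMean_sub_integral_le_of_finite [Finite ι] (hn : n ≠ 0)
    {g : ι → Ω → ℝ} (hg : ∀ i, Measurable (g i)) {B : ℝ} (hB : ∀ i ω, |g i ω| ≤ B) {κ : ℝ}
    (hκ0 : 0 < κ) (hκ : ∀ z : Fin n → Ω, IsRademacherSubgaussian κ (range fun i => g i ∘ z))
    {t : ℝ} (ht : 0 ≤ t) :
    (Measure.pi fun _ : Fin n => P) {z | ∃ i, t < sampleMean (g i) z - ∫ ω, g i ω ∂P} ≤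
      ENNReal.ofReal (Real.exp (2 - t ^ 2 * n / (16 * κ))) := by
  rcases isEmpty_or_nonempty ι with hι | hι
  · simp
  have : (0 : ℝ) < n := by positivity
  have ht' : 0 ≤ t * n / (8 * κ) := by positivity
  have hint : Integrable
      (fun z => Real.exp (t * n / (8 * κ) * ⨆ i, (sampleMean (g i) z - ∫ ω, g i ω ∂P)))
      (Measure.pi fun _ : Fin n => P) := by
    refine integrable_exp_mul_iSup (B := B + B)
      (fun i => (measurable_sampleMean (hg i)).sub_const _) (fun i z => ?_) ht'
    refine (le_abs_self _).trans ((abs_sub _ _).trans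
      (add_le_add (abs_sampleMean_le hn fun _ => hB i _) ?_))
    simpa using norm_integral_le_of_norm_le_const (μ := P) (f := g i) (ae_of_all _ (hB i))
  calc (Measure.pi fun _ : Fin n => P) {z | ∃ i, t < sampleMean (g i) z - ∫ ω, g i ω ∂P}
    _ ≤ (Measure.pi fun _ : Fin n => P)
          {z | t ≤ ⨆ i, (sampleMean (g i) z - ∫ ω, g i ω ∂P)} := by
        refine measure_mono ?_
        rintro z ⟨i, hi⟩
        exact hi.le.trans (le_ciSup (f := fun i => sampleMean (g i) z - ∫ ω, g i ω ∂P)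
          (finite_range _).bddAbove i)
    _ = ENNReal.ofReal ((Measure.pi fun _ : Fin n => P).real
          {z | t ≤ ⨆ i, (sampleMean (g i) z - ∫ ω, g i ω ∂P)}) := by simp
    _ ≤ ENNReal.ofReal (Real.exp (2 - t ^ 2 * n / (16 * κ))) := by
        refine ENNReal.ofReal_le_ofReal ((measure_ge_le_exp_mul_mgf t ht' hint).trans ?_)
        refine (mul_le_mul_of_nonneg_left (mgf_iSup_sampleMean_sub_integral_le hn hg hB hκ ht')
          (by positivity)).trans_eq ?_
        rw [← Real.exp_add]
        congr 1
        field_simp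
        ring

end Symmetrization

section UniformDeviation

/-- By the Lindelöf property of the separable set, the union may be taken over a countable
subfamily, and then over an increasing sequence of finite ones. -/
lemma measure_iUnion_le_of_forall_finset {α ι : Type*} [TopologicalSpace α]
    [TopologicalSpace.PseudoMetrizableSpace α] [MeasurableSpace α] {μ : Measure α} {S : Set α}
    (hS : TopologicalSpace.IsSeparable S) (hμS : ∀ᵐ x ∂μ, x ∈ S) {E : ι → Set α}
    (hE : ∀ i, IsOpen (E i)) {b : ℝ≥0∞} (hb : ∀ s : Finset ι, μ (⋃ i ∈ s, E i) ≤ b) :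
    μ (⋃ i, E i) ≤ b := by
  have := hS.secondCountableTopology
  obtain ⟨T, hT, hTE⟩ := TopologicalSpace.isOpen_iUnion_countable
    (fun i => ((↑) : S → α) ⁻¹' E i) fun i => (hE i).preimage continuous_subtype_val
  have hcountable : ⋃ i, E i ≤ᵐ[μ] ⋃ i : T, E i := by
    filter_upwards [hμS] with x hxS hx
    have hxS' : (⟨x, hxS⟩ : S) ∈ ⋃ i, ((↑) : S → α) ⁻¹' E i := by
      obtain ⟨i, hi⟩ := mem_iUnion.1 (show x ∈ ⋃ i, E i from hx)
      exact mem_iUnion.2 ⟨i, hi⟩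
    rw [← hTE] at hxS'
    obtain ⟨i, hiT, hxi⟩ := mem_iUnion₂.1 hxS'
    exact mem_iUnion.2 ⟨⟨i, hiT⟩, hxi⟩
  refine (measure_mono_ae hcountable).trans ?_
  have : Countable T := hT.to_subtype
  have hmono : Monotone fun s : Finset T => ⋃ i ∈ s, E i :=
    fun s t hst => biUnion_subset_biUnion_left hst
  rw [iUnion_eq_iUnion_finset, hmono.directed_le.measure_iUnion]
  refine iSup_le fun s => (measure_mono ?_).trans (hb (s.map (Function.Embedding.subtype _)))
  simp

variable {Ω ι : Type*} [TopologicalSpace Ω] [TopologicalSpace.PseudoMetrizableSpace Ω]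
  [MeasurableSpace Ω] [OpensMeasurableSpace Ω] {P : Measure Ω} [IsProbabilityMeasure P] {n : ℕ}

theorem measure_exists_lt_sampleMean_sub_integral_le (hn : n ≠ 0) {S : Set Ω}
    (hS : TopologicalSpace.IsSeparable S) (hPS : ∀ᵐ ω ∂P, ω ∈ S) {g : ι → Ω → ℝ}
    (hg : ∀ i, Continuous (g i)) {B : ℝ} (hB : ∀ i ω, |g i ω| ≤ B) {κ : ℝ} (hκ0 : 0 < κ)
    (hκ : ∀ z : Fin n → Ω, IsRademacherSubgaussian κ (range fun i => g i ∘ z)) {t : ℝ}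
    (ht : 0 ≤ t) :
    (Measure.pi fun _ : Fin n => P) {z | ∃ i, t < sampleMean (g i) z - ∫ ω, g i ω ∂P} ≤
      ENNReal.ofReal (Real.exp (2 - t ^ 2 * n / (16 * κ))) := by
  have hsample : ∀ᵐ z ∂(Measure.pi fun _ : Fin n => P), z ∈ univ.pi fun _ => S := by
    simp only [mem_univ_pi, ae_all_iff]
    exact fun i => (Measure.quasiMeasurePreserving_eval _ i).ae hPS
  rw [ofPred_exists]
  refine measure_iUnion_le_of_forall_finset (TopologicalSpace.IsSeparable.univ_pi fun _ => hS)
    hsample (fun i => ?_) fun s => ?_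
  · refine isOpen_lt continuous_const ?_
    have := hg i
    unfold sampleMean
    fun_prop
  · have hfinite := measure_exists_lt_sampleMean_sub_integral_le_of_finite (P := P) hn
      (g := fun i : s => g i) (fun i => (hg i).measurable) (fun i => hB i) hκ0
      (fun z => (hκ z).mono (range_comp_subset_range ((↑) : s → ι) fun i => g i ∘ z)) ht
    refine (measure_mono fun z hz => ?_).trans hfinite
    obtain ⟨i, his, hi⟩ := mem_iUnion₂.1 hz
    exact ⟨⟨i, his⟩, hi⟩

theorem measure_exists_lt_abs_sampleMean_sub_integral_le (hn : n ≠ 0) {S : Set Ω}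
    (hS : TopologicalSpace.IsSeparable S) (hPS : ∀ᵐ ω ∂P, ω ∈ S) {g : ι → Ω → ℝ}
    (hg : ∀ i, Continuous (g i)) {B : ℝ} (hB : ∀ i ω, |g i ω| ≤ B) {κ : ℝ} (hκ0 : 0 < κ)
    (hκ : ∀ z : Fin n → Ω, IsRademacherSubgaussian κ (range fun i => g i ∘ z)) {t : ℝ}
    (ht : 0 ≤ t) :
    (Measure.pi fun _ : Fin n => P) {z | ∃ i, t < |sampleMean (g i) z - ∫ ω, g i ω ∂P|} ≤
      ENNReal.ofReal (2 * Real.exp (2 - t ^ 2 * n / (16 * κ))) := by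
  have hneg (z : Fin n → Ω) : IsRademacherSubgaussian κ (range fun i => (-g i) ∘ z) := by
    refine (hκ z).neg.mono (range_subset_iff.2 fun i => ?_)
    exact ⟨i, by ext j; simp⟩
  have hupper := measure_exists_lt_sampleMean_sub_integral_le hn hS hPS hg hB hκ0 hκ ht
  have hlower := measure_exists_lt_sampleMean_sub_integral_le hn hS hPS (fun i => (hg i).neg)
    (fun i ω => (abs_neg _).trans_le (hB i ω)) hκ0 hneg ht
  simp only [sampleMean_neg, Pi.neg_apply, integral_neg] at hlower
  rw [two_mul, ENNReal.ofReal_add (by positivity) (by positivity)]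
  refine (measure_mono fun z hz => ?_).trans ((measure_union_le _ _).trans
    (add_le_add hupper hlower))
  obtain ⟨i, hi⟩ := hz
  rcases lt_abs.1 hi with h | h
  · exact Or.inl ⟨i, h⟩
  · exact Or.inr ⟨i, h.trans_eq (by ring)⟩

end UniformDeviation

section Kernel

lemma gaussKernel_neg (h t : ℝ) : gaussKernel h (-t) = gaussKernel h t := by
  simp [gaussKernel]

lemma continuous_gaussKernel (h : ℝ) : Continuous (gaussKernel h) := by
  unfold gaussKernel
  fun_prop

lemma gaussKernel_eq_mul_exp (h t : ℝ) :
    gaussKernel h t = gaussKernel h 0 * Real.exp (-(t ^ 2 / (2 * h ^ 2))) := by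
  simp [gaussKernel]

variable {h : ℝ}

lemma gaussKernel_pos (hh : 0 < h) (t : ℝ) : 0 < gaussKernel h t := by
  unfold gaussKernel
  have := Real.pi_pos
  positivity

lemma gaussKernel_le_of_abs_le (hh : 0 < h) {s t : ℝ} (hst : |s| ≤ |t|) :
    gaussKernel h t ≤ gaussKernel h s := by
  have := gaussKernel_pos hh 0
  rw [gaussKernel_eq_mul_exp h s, gaussKernel_eq_mul_exp h t]
  gcongr ?_ * Real.exp (-(?_ / _))
  exact sq_le_sq.2 hst

lemma abs_gaussKernel_le (hh : 0 < h) (t : ℝ) : |gaussKernel h t| ≤ gaussKernel h 0 := by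
  rw [abs_of_pos (gaussKernel_pos hh t)]
  exact gaussKernel_le_of_abs_le hh (by simp)

lemma abs_mul_exp_neg_half_sq_le (x : ℝ) : |x| * Real.exp (-(x ^ 2 / 2)) ≤ 1 := by
  rw [Real.exp_neg, ← div_eq_mul_inv, div_le_one (Real.exp_pos _)]
  nlinarith [Real.add_one_le_exp (x ^ 2 / 2), sq_nonneg (|x| - 1), sq_abs x]

lemma hasDerivAt_gaussKernel (h t : ℝ) :
    HasDerivAt (gaussKernel h) (-(t / h ^ 2) * gaussKernel h t) t := by
  have hexponent : HasDerivAt (fun t : ℝ => -(t ^ 2 / (2 * h ^ 2))) (-(2 * t / (2 * h ^ 2))) t := by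
    simpa using ((hasDerivAt_pow 2 t).div_const (2 * h ^ 2)).fun_neg
  refine (hexponent.exp.const_mul _).congr_deriv ?_
  rw [gaussKernel, mul_div_mul_left _ _ two_ne_zero]
  ring

lemma lipschitzWith_gaussKernel (hh : 0 < h) :
    LipschitzWith (gaussKernel h 0 / h).toNNReal (gaussKernel h) := by
  refine lipschitzWith_of_nnnorm_deriv_le
    (fun t => (hasDerivAt_gaussKernel h t).differentiableAt) fun t => ?_
  have h0 := gaussKernel_pos hh 0
  rw [← NNReal.coe_le_coe, coe_nnnorm, Real.coe_toNNReal _ (by positivity),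
    (hasDerivAt_gaussKernel h t).deriv]
  calc ‖-(t / h ^ 2) * gaussKernel h t‖
    _ = gaussKernel h 0 / h * (|t / h| * Real.exp (-((t / h) ^ 2 / 2))) := by
        rw [norm_mul, norm_neg, Real.norm_eq_abs, Real.norm_of_nonneg (gaussKernel_pos hh t).le,
          gaussKernel_eq_mul_exp h t, abs_div, abs_div, abs_pow, abs_of_pos hh]
        ring_nf
    _ ≤ gaussKernel h 0 / h :=
        mul_le_of_le_one_right (by positivity) (abs_mul_exp_neg_half_sq_le _)

/-- Factoring out `G_h(u) exp (-d² / (2 h²))` leaves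
`2 cosh (u d / h²) ≤ 2 exp (u² d² / (2 h⁴))`. -/
lemma gaussKernel_sub_add_gaussKernel_add_le_mul_exp (hh : 0 < h) (u d : ℝ) :
    gaussKernel h (u - d) + gaussKernel h (u + d) ≤
      2 * gaussKernel h u * Real.exp (-((1 - u ^ 2 / h ^ 2) / (2 * h ^ 2) * d ^ 2)) := by
  have hsub : -((u - d) ^ 2 / (2 * h ^ 2)) =
      -(u ^ 2 / (2 * h ^ 2)) + -(d ^ 2 / (2 * h ^ 2)) + u * d / h ^ 2 := by
    field_simp
    ring
  have hadd : -((u + d) ^ 2 / (2 * h ^ 2)) =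
      -(u ^ 2 / (2 * h ^ 2)) + -(d ^ 2 / (2 * h ^ 2)) + -(u * d / h ^ 2) := by
    field_simp
    ring
  have hu := gaussKernel_pos hh u
  calc gaussKernel h (u - d) + gaussKernel h (u + d)
    _ = 2 * gaussKernel h u * (Real.exp (-(d ^ 2 / (2 * h ^ 2))) * Real.cosh (u * d / h ^ 2)) := by
        simp only [gaussKernel, hsub, hadd, Real.exp_add, Real.cosh_eq]
        ring
    _ ≤ 2 * gaussKernel h u *
          (Real.exp (-(d ^ 2 / (2 * h ^ 2))) * Real.exp ((u * d / h ^ 2) ^ 2 / 2)) := by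
        gcongr
        exact Real.cosh_le_exp_half_sq _
    _ = 2 * gaussKernel h u * Real.exp (-((1 - u ^ 2 / h ^ 2) / (2 * h ^ 2) * d ^ 2)) := by
        rw [← Real.exp_add]
        congr 2
        field_simp
        ring

lemma gaussKernel_sub_add_gaussKernel_add_le (hh : 0 < h) {u : ℝ} (hu : |u| ≤ h) (d : ℝ) :
    gaussKernel h (u - d) + gaussKernel h (u + d) ≤ 2 * gaussKernel h u := by
  refine (gaussKernel_sub_add_gaussKernel_add_le_mul_exp hh u d).trans ?_
  refine mul_le_of_le_one_right (by linarith [gaussKernel_pos hh u]) ?_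
  have hratio : u ^ 2 / h ^ 2 ≤ 1 := by
    rw [div_le_one (by positivity)]
    exact sq_le_sq.2 (by rwa [abs_of_pos hh])
  have : 0 ≤ 1 - u ^ 2 / h ^ 2 := by linarith
  rw [Real.exp_le_one_iff, neg_nonpos]
  positivity

lemma exp_neg_le_one_sub_div {v w : ℝ} (hv : 0 ≤ v) (hvw : v ≤ w) :
    Real.exp (-v) ≤ 1 - v / (1 + w) :=
  calc Real.exp (-v)
    _ ≤ 1 / (1 + v) := by
        rw [Real.exp_neg, ← one_div]
        gcongr
        linarith [Real.add_one_le_exp v]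
    _ = 1 - v / (1 + v) := by
        field_simp
        ring
    _ ≤ 1 - v / (1 + w) := by gcongr

lemma exists_mul_sq_le_gaussKernel_sub (hh : 0 < h) {a : ℝ} (ha : a < h) (b : ℝ) :
    ∃ κ : ℝ, 0 < κ ∧ ∀ u d : ℝ, |u| ≤ a → |d| ≤ b →
      κ * d ^ 2 ≤ 2 * gaussKernel h u - (gaussKernel h (u - d) + gaussKernel h (u + d)) := by
  rcases lt_or_ge a 0 with ha0 | ha0
  · exact ⟨1, one_pos, fun u d hu => absurd (abs_nonneg u) (by linarith)⟩
  set β : ℝ := (1 - a ^ 2 / h ^ 2) / (2 * h ^ 2) with hβ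
  have hβ0 : 0 < β := by
    have : a ^ 2 / h ^ 2 < 1 := by
      rw [div_lt_one (by positivity)]
      gcongr
    have : 0 < 1 - a ^ 2 / h ^ 2 := by linarith
    positivity
  have hGa := gaussKernel_pos hh a
  refine ⟨2 * gaussKernel h a * (β / (1 + β * b ^ 2)), by positivity, fun u d hu hd => ?_⟩
  have hu2 : u ^ 2 ≤ a ^ 2 := sq_le_sq.2 (by rwa [abs_of_nonneg ha0])
  have hd2 : d ^ 2 ≤ b ^ 2 := sq_le_sq.2 (hd.trans (le_abs_self b))
  have hGu : gaussKernel h a ≤ gaussKernel h u :=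
    gaussKernel_le_of_abs_le hh (by rwa [abs_of_nonneg ha0])
  have hexp : Real.exp (-((1 - u ^ 2 / h ^ 2) / (2 * h ^ 2) * d ^ 2)) ≤
      1 - β * d ^ 2 / (1 + β * b ^ 2) :=
    calc Real.exp (-((1 - u ^ 2 / h ^ 2) / (2 * h ^ 2) * d ^ 2))
      _ ≤ Real.exp (-(β * d ^ 2)) := by
          rw [hβ]
          gcongr
      _ ≤ 1 - β * d ^ 2 / (1 + β * b ^ 2) :=
          exp_neg_le_one_sub_div (by positivity) (by gcongr)
  calc 2 * gaussKernel h a * (β / (1 + β * b ^ 2)) * d ^ 2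
    _ = 2 * gaussKernel h a * (β * d ^ 2 / (1 + β * b ^ 2)) := by ring
    _ ≤ 2 * gaussKernel h u * (β * d ^ 2 / (1 + β * b ^ 2)) := by gcongr
    _ ≤ 2 * gaussKernel h u *
          (1 - Real.exp (-((1 - u ^ 2 / h ^ 2) / (2 * h ^ 2) * d ^ 2))) :=
        mul_le_mul_of_nonneg_left (by linarith) (by linarith)
    _ ≤ 2 * gaussKernel h u - (gaussKernel h (u - d) + gaussKernel h (u + d)) := by
        linarith [gaussKernel_sub_add_gaussKernel_add_le_mul_exp hh u d]

end Kernel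

section Calibration

lemma integrable_gaussKernel_comp {Ω : Type*} [MeasurableSpace Ω] {μ : Measure Ω}
    [IsFiniteMeasure μ] {h : ℝ} (hh : 0 < h) {φ : Ω → ℝ} (hφ : Measurable φ) :
    Integrable (fun ω => gaussKernel h (φ ω)) μ :=
  Integrable.of_bound ((continuous_gaussKernel h).measurable.comp hφ).aestronglyMeasurable _
    (ae_of_all _ fun _ => abs_gaussKernel_le hh _)

lemma integral_sub_sq_prod_self {Ω : Type*} [MeasurableSpace Ω] {μ : Measure Ω}
    [IsProbabilityMeasure μ] {Y : Ω → ℝ} (hY : MemLp Y 2 μ) :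
    ∫ w, (Y w.1 - Y w.2) ^ 2 ∂(μ.prod μ) = 2 * Var[Y; μ] := by
  have hmean : ∫ w, (Y w.1 - Y w.2) ∂(μ.prod μ) = 0 := by
    have hint := hY.integrable one_le_two
    rw [integral_sub (hint.comp_fst μ) (hint.comp_snd μ), integral_fun_fst, integral_fun_snd]
    simp
  have hvar := variance_add_prod hY hY.neg
  simp only [Pi.neg_apply, ← sub_eq_add_neg, variance_neg] at hvar
  rw [← variance_of_integral_eq_zero
    (hY.aemeasurable.comp_fst.fun_sub hY.aemeasurable.comp_snd) hmean, hvar, two_mul]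

variable {X : Type*}

/-- The difference of the residuals `y - f(x)` of a pair of observations. -/
def residualDiff (f : X → ℝ) (w : (X × ℝ) × X × ℝ) : ℝ :=
  (w.1.2 - f w.1.1) - (w.2.2 - f w.2.1)

lemma residualDiff_eq_sub (fstar f : X → ℝ) (w : (X × ℝ) × X × ℝ) :
    residualDiff f w =
      residualDiff fstar w - ((f w.1.1 - fstar w.1.1) - (f w.2.1 - fstar w.2.1)) := by
  unfold residualDiff
  ring

lemma residualDiff_two_mul_sub (fstar f : X → ℝ) (w : (X × ℝ) × X × ℝ) :
    residualDiff (fun x => 2 * fstar x - f x) w =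
      residualDiff fstar w + ((f w.1.1 - fstar w.1.1) - (f w.2.1 - fstar w.2.1)) := by
  unfold residualDiff
  ring

variable [MeasurableSpace X]

lemma adjustedErrorSq_eq_variance {μ : Measure X} {fstar f : X → ℝ} (hfstar : Measurable fstar)
    (hf : Measurable f) : adjustedErrorSq μ fstar f = Var[fun x => f x - fstar x; μ] := by
  have hneg : ∫ x, (fstar x - f x) ∂μ = -∫ x, (f x - fstar x) ∂μ := by
    rw [← integral_neg]
    simp
  rw [variance_eq_integral (hf.fun_sub hfstar).aemeasurable, adjustedErrorSq, hneg]
  congr with x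
  ring

lemma informationError_add_const (ρ : Measure (X × ℝ)) (h : ℝ) (f : X → ℝ) (b : ℝ) :
    informationError ρ h (fun x => f x + b) = informationError ρ h f := by
  simp only [informationError, ← sub_sub, sub_sub_sub_cancel_right]

/-- The law `ρ` of `(X, Y)` is symmetric about the regression function `f`: given `X = x`, the
noise `Y - f(x)` is symmetric about `0`. This is expressed without conditional laws, as invariance
of `ρ` under the reflection `y ↦ 2 f(x) - y`. -/
def IsSymmetricAbout (ρ : Measure (X × ℝ)) (f : X → ℝ) : Prop :=
  MeasurePreserving (fun z : X × ℝ => (z.1, 2 * f z.1 - z.2)) ρ ρ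

variable {ρ : Measure (X × ℝ)} {fstar f : X → ℝ} {p : X → ℝ → ℝ} {h D m : ℝ}

lemma measurable_residualDiff (hf : Measurable f) : Measurable (residualDiff f) := by
  unfold residualDiff
  fun_prop

lemma ae_abs_residualDiff_le (hm : ∀ᵐ z ∂ρ, |z.2 - f z.1| ≤ m) :
    ∀ᵐ w ∂(ρ.prod ρ), |residualDiff f w| ≤ 2 * m := by
  filter_upwards [Measure.quasiMeasurePreserving_fst.ae hm,
    Measure.quasiMeasurePreserving_snd.ae hm] with w hw₁ hw₂
  exact (abs_sub _ _).trans (by linarith)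

lemma IsNoiseDensity.ae_abs_sub_le (hp : IsNoiseDensity ρ fstar p) (hfstar : Measurable fstar)
    (hm : ∀ x, Function.support (p x) ⊆ Icc (-m) m) : ∀ᵐ z ∂ρ, |z.2 - fstar z.1| ≤ m := by
  have hnoise : ∀ᵐ w ∂(ρ.map fun z : X × ℝ => (z.1, z.2 - fstar z.1)), |w.2| ≤ m := by
    have hdensity : Measurable fun w : X × ℝ => ENNReal.ofReal (p w.1 w.2) :=
      hp.measurable.ennreal_ofReal
    rw [hp.joint_law, ae_withDensity_iff hdensity]
    refine ae_of_all _ fun w hw => abs_le.2 (hm w.1 fun hzero => hw ?_)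
    rw [hzero, ENNReal.ofReal_zero]
  exact ae_of_ae_map (by fun_prop) hnoise

/-- The change of variables `(x, y) ↦ (x, y - f x)` from responses to noise. -/
def noiseEquiv (f : X → ℝ) (hf : Measurable f) : X × ℝ ≃ᵐ X × ℝ where
  toFun z := (z.1, z.2 - f z.1)
  invFun z := (z.1, z.2 + f z.1)
  left_inv z := by simp
  right_inv z := by simp
  measurable_toFun := by
    simp only [Equiv.coe_fn_mk]
    fun_prop
  measurable_invFun := by
    simp only [Equiv.coe_fn_symm_mk]
    fun_prop

lemma measurePreserving_neg_snd_withDensity {μ : Measure X} [SFinite μ]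
    (hp : Measurable (Function.uncurry p)) (heven : ∀ x, Function.Even (p x)) :
    MeasurePreserving (Prod.map id Neg.neg)
      ((μ.prod volume).withDensity fun w => ENNReal.ofReal (p w.1 w.2))
      ((μ.prod volume).withDensity fun w => ENNReal.ofReal (p w.1 w.2)) := by
  have hneg : MeasurePreserving (Prod.map id Neg.neg : X × ℝ → X × ℝ)
      (μ.prod volume) (μ.prod volume) :=
    (MeasurePreserving.id _).prod (Measure.measurePreserving_neg volume)
  have hdensity : Measurable fun w : X × ℝ => ENNReal.ofReal (p w.1 w.2) := hp.ennreal_ofReal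
  refine ⟨hneg.measurable, Measure.ext fun s hs => ?_⟩
  rw [Measure.map_apply hneg.measurable hs, withDensity_apply _ hs,
    withDensity_apply _ (hneg.measurable hs), ← hneg.setLIntegral_comp_preimage hs hdensity]
  simp only [Prod.map_fst, Prod.map_snd, id, (heven _) _]

lemma IsNoiseDensity.isSymmetricAbout [SFinite ρ] (hp : IsNoiseDensity ρ fstar p)
    (hfstar : Measurable fstar) (heven : ∀ x, Function.Even (p x)) :
    IsSymmetricAbout ρ fstar := by
  have hnoise : MeasurePreserving (noiseEquiv fstar hfstar) ρ
      ((ρ.fst.prod volume).withDensity fun w => ENNReal.ofReal (p w.1 w.2)) :=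
    ⟨(noiseEquiv fstar hfstar).measurable, hp.joint_law⟩
  have hneg := measurePreserving_neg_snd_withDensity (μ := ρ.fst) hp.measurable heven
  unfold IsSymmetricAbout
  convert (hnoise.symm.comp hneg).comp hnoise using 1
  ext z
  · rfl
  · simp only [noiseEquiv, Function.comp_apply, MeasurableEquiv.coe_mk, Equiv.coe_fn_mk,
      MeasurableEquiv.symm_mk, Equiv.coe_fn_symm_mk, Prod.map_fst, Prod.map_snd, id]
    ring

variable [IsProbabilityMeasure ρ]

lemma integrable_gaussKernel_residualDiff (hh : 0 < h) (hf : Measurable f) :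
    Integrable (fun w => gaussKernel h (residualDiff f w)) (ρ.prod ρ) :=
  integrable_gaussKernel_comp hh (measurable_residualDiff hf)

lemma informationError_eq_neg_integral_prod (hh : 0 < h) (hf : Measurable f) :
    informationError ρ h f = -∫ w, gaussKernel h (residualDiff f w) ∂(ρ.prod ρ) := by
  rw [integral_prod _ (integrable_gaussKernel_residualDiff hh hf)]
  rfl

lemma IsSymmetricAbout.informationError_two_mul_sub (hsymm : IsSymmetricAbout ρ fstar)
    (hh : 0 < h) (hfstar : Measurable fstar) (hf : Measurable f) :
    informationError ρ h (fun x => 2 * fstar x - f x) = informationError ρ h f := by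
  have hreflect := MeasurePreserving.prod hsymm hsymm
  have hkernel : Measurable fun w => gaussKernel h (residualDiff f w) :=
    (continuous_gaussKernel h).measurable.comp (measurable_residualDiff hf)
  rw [informationError_eq_neg_integral_prod hh ((hfstar.const_mul 2).fun_sub hf),
    informationError_eq_neg_integral_prod hh hf]
  conv_rhs => rw [← hreflect.map_eq]
  rw [integral_map hreflect.aemeasurable hkernel.aestronglyMeasurable]
  congr with w
  rw [← gaussKernel_neg]
  congr 1
  simp only [residualDiff, Prod.map_fst, Prod.map_snd]
  ring

lemma IsSymmetricAbout.two_mul_informationError_sub (hsymm : IsSymmetricAbout ρ fstar)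
    (hh : 0 < h) (hfstar : Measurable fstar) (hf : Measurable f) :
    2 * (informationError ρ h f - informationError ρ h fstar) =
      ∫ w, (2 * gaussKernel h (residualDiff fstar w) - (gaussKernel h (residualDiff f w) +
        gaussKernel h (residualDiff (fun x => 2 * fstar x - f x) w))) ∂(ρ.prod ρ) := by
  have hrefl : Measurable fun x => 2 * fstar x - f x := (hfstar.const_mul 2).sub hf
  have hint {g : X → ℝ} := integrable_gaussKernel_residualDiff (ρ := ρ) (f := g) hh
  rw [integral_sub ((hint hfstar).const_mul 2) ((hint hf).fun_add (hint hrefl)),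
    integral_const_mul, integral_add (hint hf) (hint hrefl),
    ← neg_neg (∫ w, gaussKernel h (residualDiff (fun x => 2 * fstar x - f x) w) ∂_),
    ← informationError_eq_neg_integral_prod hh hrefl,
    hsymm.informationError_two_mul_sub hh hfstar hf, informationError_eq_neg_integral_prod hh hf,
    informationError_eq_neg_integral_prod hh hfstar]
  ring

theorem IsSymmetricAbout.isMinOn_informationError (hsymm : IsSymmetricAbout ρ fstar)
    (hm : ∀ᵐ z ∂ρ, |z.2 - fstar z.1| ≤ m) (hh : 0 < h) (hmh : 2 * m ≤ h)
    (hfstar : Measurable fstar) : IsMinOn (informationError ρ h) {f | Measurable f} fstar := by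
  intro f hf
  have hexcess := hsymm.two_mul_informationError_sub hh hfstar hf
  have hnonneg : 0 ≤ ∫ w, (2 * gaussKernel h (residualDiff fstar w) -
      (gaussKernel h (residualDiff f w) +
        gaussKernel h (residualDiff (fun x => 2 * fstar x - f x) w))) ∂(ρ.prod ρ) := by
    refine integral_nonneg_of_ae ?_
    filter_upwards [ae_abs_residualDiff_le hm] with w hw
    rw [residualDiff_eq_sub fstar f, residualDiff_two_mul_sub]
    exact sub_nonneg.2 (gaussKernel_sub_add_gaussKernel_add_le hh (hw.trans hmh) _)
  change informationError ρ h fstar ≤ informationError ρ h f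
  linarith

theorem IsSymmetricAbout.exists_mul_adjustedErrorSq_le (hsymm : IsSymmetricAbout ρ fstar)
    (hm : ∀ᵐ z ∂ρ, |z.2 - fstar z.1| ≤ m) (hh : 0 < h) (hmh : 2 * m < h)
    (hfstar : Measurable fstar) (D : ℝ) :
    ∃ κ : ℝ, 0 < κ ∧ ∀ f : X → ℝ, Measurable f → (∀ x, |f x - fstar x| ≤ D) →
      κ * adjustedErrorSq ρ.fst fstar f ≤
        informationError ρ h f - informationError ρ h fstar := by
  obtain ⟨κ, hκ, hgap⟩ := exists_mul_sq_le_gaussKernel_sub hh hmh (2 * D)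
  refine ⟨κ, hκ, fun f hf hD => ?_⟩
  have hdiff : Measurable fun x => f x - fstar x := hf.sub hfstar
  have hLp : MemLp (fun z : X × ℝ => f z.1 - fstar z.1) 2 ρ :=
    MemLp.of_bound (by fun_prop) D (ae_of_all _ fun z => hD z.1)
  have hvar : Var[fun z : X × ℝ => f z.1 - fstar z.1; ρ] = adjustedErrorSq ρ.fst fstar f := by
    rw [adjustedErrorSq_eq_variance hfstar hf]
    exact (measurable_fst.measurePreserving ρ).variance_fun_comp hdiff.aemeasurable
  have hpairs : ∫ w : (X × ℝ) × X × ℝ,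
      κ * ((f w.1.1 - fstar w.1.1) - (f w.2.1 - fstar w.2.1)) ^ 2 ∂(ρ.prod ρ) ≤
      2 * (informationError ρ h f - informationError ρ h fstar) := by
    rw [hsymm.two_mul_informationError_sub hh hfstar hf]
    refine integral_mono_ae ?_ ?_ ?_
    · exact (((hLp.comp_fst ρ).sub (hLp.comp_snd ρ)).integrable_sq).const_mul κ
    · have hint {g : X → ℝ} := integrable_gaussKernel_residualDiff (ρ := ρ) (f := g) hh
      exact ((hint hfstar).const_mul 2).sub
        ((hint hf).add (hint ((hfstar.const_mul 2).sub hf)))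
    · filter_upwards [ae_abs_residualDiff_le hm] with w hw
      rw [residualDiff_eq_sub fstar f, residualDiff_two_mul_sub]
      refine hgap _ _ hw ((abs_sub _ _).trans ?_)
      linarith [hD w.1.1, hD w.2.1]
  rw [integral_const_mul, integral_sub_sq_prod_self hLp, hvar] at hpairs
  linarith

end Calibration

section Entropy

variable {n : ℕ} {N N' r r' : ℝ} {A A' : Set (Fin n → ℝ)}

lemma HasCover.mono (hA : HasCover N r A) (hN : N ≤ N') (hr : 0 ≤ r) (hr' : r ≤ r') :
    HasCover N' r' A := by
  obtain ⟨C, hcard, hC⟩ := hA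
  refine ⟨C, hcard.trans hN, fun v hv => ?_⟩
  obtain ⟨u, hu, hvu⟩ := hC v hv
  exact ⟨u, hu, hvu.trans (by gcongr)⟩

lemma HasCover.subset (hA' : HasCover N r A') (h : A ⊆ A') : HasCover N r A := by
  obtain ⟨C, hcard, hC⟩ := hA'
  exact ⟨C, hcard, fun v hv => hC v (h hv)⟩

lemma HasCover.add (hA : HasCover N r A) (hA' : HasCover N' r A') :
    HasCover (N * N') (2 * r) (A + A') := by
  classical
  obtain ⟨C, hcard, hC⟩ := hA
  obtain ⟨C', hcard', hC'⟩ := hA'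
  refine ⟨C + C', ?_, ?_⟩
  · calc ((C + C').card : ℝ) ≤ C.card * C'.card := mod_cast Finset.card_add_le
      _ ≤ N * N' := mul_le_mul hcard hcard' (by positivity) ((Nat.cast_nonneg _).trans hcard)
  · rintro _ ⟨v, hv, v', hv', rfl⟩
    obtain ⟨u, hu, hvu⟩ := hC v hv
    obtain ⟨u', hu', hvu'⟩ := hC' v' hv'
    refine ⟨u + u', Finset.add_mem_add hu hu', ?_⟩
    calc ∑ i, ((v + v') i - (u + u') i) ^ 2
      _ ≤ 2 * ∑ i, ((u + v') i - (v + v') i) ^ 2 + 2 * ∑ i, ((u + v') i - (u + u') i) ^ 2 :=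
          sum_sub_sq_le _ _ _
      _ = 2 * ∑ i, (v i - u i) ^ 2 + 2 * ∑ i, (v' i - u' i) ^ 2 := by
          simp only [Pi.add_apply, add_sub_add_right_eq_sub, add_sub_add_left_eq_sub,
            sub_sq_comm (u _)]
      _ ≤ 2 * (n * r ^ 2) + 2 * (n * r ^ 2) := by gcongr
      _ = n * (2 * r) ^ 2 := by ring

lemma HasCover.image_of_lipschitzWith (hA : HasCover N r A) {l : ℝ≥0} {ψ : Fin n → ℝ → ℝ}
    (hψ : ∀ i, LipschitzWith l (ψ i)) :
    HasCover N (l * r) ((fun v i => ψ i (v i)) '' A) := by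
  classical
  obtain ⟨C, hcard, hC⟩ := hA
  refine ⟨C.image fun u i => ψ i (u i), le_trans (mod_cast Finset.card_image_le) hcard, ?_⟩
  rintro _ ⟨v, hv, rfl⟩
  obtain ⟨u, hu, hvu⟩ := hC v hv
  refine ⟨_, Finset.mem_image_of_mem _ hu, ?_⟩
  calc ∑ i, (ψ i (v i) - ψ i (u i)) ^ 2 ≤ ∑ i, (l * |v i - u i|) ^ 2 := by
        refine Finset.sum_le_sum fun i _ => sq_le_sq.2 (le_trans ?_ (le_abs_self _))
        exact (hψ i).dist_le_mul _ _
    _ = l ^ 2 * ∑ i, (v i - u i) ^ 2 := by simp only [mul_pow, sq_abs, Finset.mul_sum]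
    _ ≤ l ^ 2 * (n * r ^ 2) := by gcongr
    _ = n * (l * r) ^ 2 := by ring

lemma hasCover_image_const_Icc {R : ℝ} (hR : 0 ≤ R) (hr : 0 < r) :
    HasCover (2 * R / r + 2) r ((fun t (_ : Fin n) => t) '' Icc (-R) R) := by
  classical
  refine ⟨(Finset.Icc ⌊-R / r⌋ ⌊R / r⌋).image fun (k : ℤ) _ => r * k, ?_, ?_⟩
  · have floor_le : ⌊-R / r⌋ ≤ ⌊R / r⌋ := by gcongr; linarith
    have card_eq : ((Finset.Icc ⌊-R / r⌋ ⌊R / r⌋).card : ℝ) = ⌊R / r⌋ + 1 - ⌊-R / r⌋ := by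
      rw [← Int.cast_natCast, Int.card_Icc_of_le _ _ (by linarith)]
      push_cast
      ring
    calc _ ≤ ((Finset.Icc ⌊-R / r⌋ ⌊R / r⌋).card : ℝ) := mod_cast Finset.card_image_le
      _ = ⌊R / r⌋ + 1 - ⌊-R / r⌋ := card_eq
      _ ≤ R / r + 1 - (-R / r - 1) := by
          gcongr
          · exact Int.floor_le _
          · exact (Int.sub_one_lt_floor _).le
      _ = 2 * R / r + 2 := by ring
  · rintro _ ⟨t, ht, rfl⟩
    refine ⟨fun _ => r * ⌊t / r⌋, Finset.mem_image.2 ⟨⌊t / r⌋, Finset.mem_Icc.2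
      ⟨Int.floor_le_floor (by gcongr; exact ht.1), Int.floor_le_floor (by gcongr; exact ht.2)⟩,
      rfl⟩, ?_⟩
    have t_eq : r * (t / r) = t := mul_div_cancel₀ t hr.ne'
    have floor_lower : r * ⌊t / r⌋ ≤ t := by
      nlinarith [mul_le_mul_of_nonneg_left (Int.floor_le (t / r)) hr.le]
    have floor_upper : t ≤ r * ⌊t / r⌋ + r := by
      nlinarith [mul_le_mul_of_nonneg_left (Int.lt_floor_add_one (t / r)).le hr.le]
    calc ∑ _i : Fin n, (t - r * ⌊t / r⌋) ^ 2 = n * (t - r * ⌊t / r⌋) ^ 2 := by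
          rw [Finset.sum_const, Finset.card_fin, nsmul_eq_mul]
      _ ≤ n * r ^ 2 := by gcongr; linarith

lemma hasCover_of_externalCoveringNumber_le {m : ℕ} {ε : ℝ≥0}
    (h : Metric.externalCoveringNumber (ε * NNReal.sqrt n)
      ((WithLp.toLp 2 : (Fin n → ℝ) → EuclideanSpace ℝ (Fin n)) '' A) ≤ m) :
    HasCover m ε A := by
  classical
  rw [← ENat.lt_add_one_iff (ENat.natCast_ne_top m)] at h
  simp only [Metric.externalCoveringNumber, iInf_lt_iff] at h
  obtain ⟨C, hC, hcard⟩ := h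
  rw [ENat.lt_add_one_iff (ENat.natCast_ne_top m)] at hcard
  have hfin : C.Finite :=
    Set.encard_ne_top_iff.1 (ne_top_of_le_ne_top (ENat.natCast_ne_top m) hcard)
  rw [hfin.encard_eq_coe_toFinset_card, Nat.cast_le] at hcard
  refine ⟨hfin.toFinset.image WithLp.ofLp, mod_cast Finset.card_image_le.trans hcard,
    fun v hv => ?_⟩
  obtain ⟨u, hu, hvu⟩ := hC (mem_image_of_mem _ hv)
  refine ⟨_, Finset.mem_image_of_mem _ (hfin.mem_toFinset.2 hu), ?_⟩
  have dist_le : dist (WithLp.toLp 2 v : EuclideanSpace ℝ (Fin n)) u ≤ ε * √n := by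
    have : nndist (WithLp.toLp 2 v : EuclideanSpace ℝ (Fin n)) u ≤ ε * NNReal.sqrt n := by
      rw [← ENNReal.coe_le_coe, ← edist_nndist]
      exact hvu
    simpa only [← NNReal.coe_le_coe, coe_nndist, NNReal.coe_mul, Real.coe_sqrt,
      NNReal.coe_natCast] using this
  calc ∑ i, (v i - u i) ^ 2 = dist (WithLp.toLp 2 v : EuclideanSpace ℝ (Fin n)) u ^ 2 := by
        rw [EuclideanSpace.dist_eq, Real.sq_sqrt (by positivity)]
        simp only [Real.dist_eq, sq_abs]
    _ ≤ (ε * √n) ^ 2 := by gcongr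
    _ = n * (ε : ℝ) ^ 2 := by rw [mul_pow, Real.sq_sqrt (Nat.cast_nonneg n), mul_comm]

/-- The polynomial entropy condition `log 𝒩₂(H, ε) ≤ c ε^{-s}`. Finiteness of the covering number
is part of it, since `ENat.toNat ⊤ = 0` and `Real.log 0 = 0` would make the inequality trivial. -/
def HasPolynomialEntropy {X : Type*} (H : Set (X → ℝ)) (c s : ℝ) : Prop :=
  ∀ ε : ℝ≥0, 0 < ε → empiricalCoveringNumber H ε ≠ ⊤ ∧
    Real.log ((empiricalCoveringNumber H ε).toNat : ℝ) ≤ c * (ε : ℝ) ^ (-s)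

variable {X : Type*} {H : Set (X → ℝ)} {c s : ℝ}

lemma HasPolynomialEntropy.nonneg (hH : HasPolynomialEntropy H c s) : 0 ≤ c := by
  simpa only [NNReal.coe_one, Real.one_rpow, mul_one] using
    (Real.log_natCast_nonneg _).trans (hH 1 one_pos).2

lemma HasPolynomialEntropy.hasCover (hH : HasPolynomialEntropy H c s) (hn : n ≠ 0)
    (x : Fin n → X) {ε : ℝ≥0} (hε : 0 < ε) :
    HasCover (Real.exp (c * (ε : ℝ) ^ (-s))) ε ((fun f i => f (x i)) '' H) := by
  obtain ⟨htop, hlog⟩ := hH ε hε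
  have hcover : HasCover ((empiricalCoveringNumber H ε).toNat) ε ((fun f i => f (x i)) '' H) := by
    refine hasCover_of_externalCoveringNumber_le ?_
    rw [ENat.natCast_toNat htop, image_image]
    exact le_iSup₂_of_le n (Nat.one_le_iff_ne_zero.2 hn) (le_iSup_of_le x le_rfl)
  refine hcover.mono ?_ ε.2 le_rfl
  rcases (Nat.cast_nonneg (α := ℝ) (empiricalCoveringNumber H ε).toNat).eq_or_lt with h0 | hpos
  · exact h0 ▸ (Real.exp_pos _).le
  · exact (Real.log_le_iff_le_exp hpos).1 hlog

lemma rpow_neg_inv_two_pow (s : ℝ) (k : ℕ) : (((2 : ℝ) ^ k)⁻¹) ^ (-s) = ((2 : ℝ) ^ s) ^ k := by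
  rw [Real.inv_rpow (by positivity), Real.rpow_neg (by positivity), inv_inv,
    Real.rpow_pow_comm (by norm_num)]

lemma HasPolynomialEntropy.hasCover_residuals (hH : HasPolynomialEntropy H c s) {l : ℝ≥0}
    {ψ : ℝ → ℝ} (hψ : LipschitzWith l ψ) {R : ℝ} (hR : 0 ≤ R) (hn : n ≠ 0) (z : Fin n → X × ℝ)
    (k : ℕ) :
    HasCover (Real.exp ((c + (2 * R + 2)) * max 2 (2 ^ s) ^ k)) (2 * l / 2 ^ k)
      (range fun (q : H × Icc (-R) R) i => ψ ((z i).2 - q.1.1 (z i).1 - q.2)) := by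
  set τ : ℝ := max 2 (2 ^ s)
  have range_subset : (range fun (q : H × Icc (-R) R) i => ψ ((z i).2 - q.1.1 (z i).1 - q.2)) ⊆
      (fun v i => ψ ((z i).2 - v i)) '' (((fun f i => f (z i).1) '' H) +
        ((fun t _ => t) '' Icc (-R) R)) := by
    rintro _ ⟨⟨f, t⟩, rfl⟩
    refine ⟨_, add_mem_add (mem_image_of_mem _ f.2) (mem_image_of_mem _ t.2), ?_⟩
    simp only [Pi.add_apply, sub_sub]
  have hlip (i : Fin n) : LipschitzWith l fun t => ψ ((z i).2 - t) :=
    mul_one l ▸ hψ.comp (LipschitzWith.of_dist_le_mul fun a b => by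
      rw [dist_sub_left, NNReal.coe_one, one_mul])
  have hcov := hH.hasCover hn (fun i => (z i).1) (ε := (2 ^ k)⁻¹) (by positivity)
  push_cast at hcov
  rw [rpow_neg_inv_two_pow] at hcov
  have hsum := (hcov.add (hasCover_image_const_Icc hR (by positivity))).image_of_lipschitzWith hlip
  refine (hsum.subset range_subset).mono ?_ (by positivity) (le_of_eq (by ring))
  rw [add_mul, Real.exp_add]
  have h2τ : (2 : ℝ) ^ k ≤ τ ^ k := by gcongr; exact le_max_left _ _
  have hsτ : ((2 : ℝ) ^ s) ^ k ≤ τ ^ k := by gcongr; exact le_max_right _ _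
  gcongr
  · exact hH.nonneg
  · have := one_le_pow₀ (M₀ := ℝ) one_le_two (n := k)
    calc 2 * R / (2 ^ k)⁻¹ + 2 ≤ (2 * R + 2) * 2 ^ k := by
          rw [div_inv_eq_mul]; linarith
      _ ≤ (2 * R + 2) * τ ^ k := by gcongr
      _ ≤ Real.exp ((2 * R + 2) * τ ^ k) := by
          linarith [Real.add_one_le_exp ((2 * R + 2) * τ ^ k)]

theorem HasPolynomialEntropy.exists_isRademacherSubgaussian (hH : HasPolynomialEntropy H c s)
    (hs : s < 2) {l : ℝ≥0} {ψ : ℝ → ℝ} (hψ : LipschitzWith l ψ) {B : ℝ} (hB : ∀ t, |ψ t| ≤ B)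
    {R : ℝ} (hR : 0 ≤ R) :
    ∃ κ > 0, ∀ n : ℕ, n ≠ 0 → ∀ z : Fin n → X × ℝ, IsRademacherSubgaussian κ
      (range fun (q : H × Icc (-R) R) i => ψ ((z i).2 - q.1.1 (z i).1 - q.2)) := by
  set τ : ℝ := max 2 (2 ^ s)
  have hτ2 : 2 ≤ τ := le_max_left _ _
  have hτ4 : τ < 4 := max_lt (by norm_num) <|
    calc (2 : ℝ) ^ s < 2 ^ (2 : ℝ) := Real.rpow_lt_rpow_of_exponent_lt one_lt_two hs
      _ = 4 := by norm_num
  have hsqrt : 0 < 1 - √τ / 2 := by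
    have : √τ < 2 := (Real.sqrt_lt' two_pos).2 (by linarith)
    linarith
  have hB0 : 0 ≤ B := (abs_nonneg _).trans (hB 0)
  have hc := hH.nonneg
  set L : ℝ := B + 2 * l + 1
  have hL : 0 < L := by positivity
  refine ⟨5 / 4 * (1 + 5 * (c + (2 * R + 2))) * L ^ 2 / (1 - √τ / 2) ^ 2, by positivity,
    fun n hn z => isRademacherSubgaussian_of_hasCover hL.le (by positivity) (by linarith) hτ4 ?_
      fun k => (hH.hasCover_residuals hψ hR hn z k).mono le_rfl (by positivity) ?_⟩
  · rintro _ ⟨q, rfl⟩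
    calc ∑ i, ψ ((z i).2 - q.1.1 (z i).1 - q.2) ^ 2 ≤ ∑ _i : Fin n, L ^ 2 := by
          refine Finset.sum_le_sum fun i _ => sq_le_sq.2 ((hB _).trans ?_)
          rw [abs_of_pos hL]
          linarith [l.coe_nonneg]
      _ = n * L ^ 2 := by rw [Finset.sum_const, Finset.card_fin, nsmul_eq_mul]
  · gcongr
    linarith

end Entropy

section VStatistic

variable {Ω : Type*} [MeasurableSpace Ω] {P : Measure Ω} [IsProbabilityMeasure P] {n : ℕ}

/-- Replacing the two averages by integrals one after the other costs `t` each time. -/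
lemma abs_sampleMean_sampleMean_sub_integral_le (hn : n ≠ 0) {K : Ω → Ω → ℝ}
    (hK : Integrable (Function.uncurry K) (P.prod P)) (hK' : ∀ a, Integrable (K a) P)
    (hsymm : ∀ a b, K a b = K b a) {G : Set Ω} (hG : ∀ᵐ ω ∂P, ω ∈ G) {z : Fin n → Ω}
    (hz : ∀ i, z i ∈ G) {t : ℝ} (ht : ∀ a ∈ G, |sampleMean (K a) z - ∫ b, K a b ∂P| ≤ t) :
    |sampleMean (fun a => sampleMean (K a) z) z - ∫ a, ∫ b, K a b ∂P ∂P| ≤ 2 * t := by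
  have hint (i : Fin n) : Integrable (fun a => K a (z i)) P := by
    simpa only [hsymm _ (z i)] using hK' (z i)
  have integral_sampleMean_eq :
      ∫ a, sampleMean (K a) z ∂P = sampleMean (fun a => ∫ b, K a b ∂P) z := by
    simp only [sampleMean]
    rw [integral_div, integral_finsetSum _ fun i _ => hint i]
    simp only [hsymm _ (z _)]
  have hsample : |sampleMean (fun a => sampleMean (K a) z) z - ∫ a, sampleMean (K a) z ∂P| ≤ t := by
    rw [integral_sampleMean_eq, sampleMean_sub]
    exact abs_sampleMean_le hn fun i => ht _ (hz i)
  have hlaw : |∫ a, sampleMean (K a) z ∂P - ∫ a, ∫ b, K a b ∂P ∂P| ≤ t := by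
    have hmean : Integrable (fun a => sampleMean (K a) z) P :=
      (integrable_finsetSum _ fun i _ => hint i).div_const _
    have hinner : Integrable (fun a => ∫ b, K a b ∂P) P := hK.integral_prod_left
    rw [← integral_sub hmean hinner]
    simpa using norm_integral_le_of_norm_le_const
      (f := fun a => sampleMean (K a) z - ∫ b, K a b ∂P) (hG.mono ht)
  linarith [abs_sub_le (sampleMean (fun a => sampleMean (K a) z) z)
    (∫ a, sampleMean (K a) z ∂P) (∫ a, ∫ b, K a b ∂P ∂P)]

end VStatistic

section EmpiricalPotential

variable {X : Type*} {H : Set (X → ℝ)} {f g : X → ℝ} {h R t : ℝ} {n : ℕ} {z : Fin n → X × ℝ}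

/-- The empirical information potential `n⁻² ∑_{i,j} G_h(e_i - e_j)`, `e_i = y_i - f(x_i)`: the
V-statistic whose population version is `-informationError`. -/
noncomputable def empiricalPotential (h : ℝ) (z : Fin n → X × ℝ) (f : X → ℝ) : ℝ :=
  sampleMean (fun w => sampleMean (fun w' => gaussKernel h (residualDiff f (w, w'))) z) z

lemma empiricalRenyi_eq_neg_log (h : ℝ) (z : Fin n → X × ℝ) (f : X → ℝ) :
    empiricalRenyi h z f = -Real.log (empiricalPotential h z f) := by
  simp only [empiricalRenyi, empiricalPotential, sampleMean, residualDiff]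
  rw [← Finset.sum_div, div_div, ← sq, one_div_mul_eq_div]

lemma empiricalPotential_pos (hh : 0 < h) (hn : n ≠ 0) (z : Fin n → X × ℝ) (f : X → ℝ) :
    0 < empiricalPotential h z f := by
  have : Nonempty (Fin n) := ⟨⟨0, Nat.pos_of_ne_zero hn⟩⟩
  have hn' : (0 : ℝ) < n := by positivity
  exact div_pos (Finset.sum_pos (fun i _ => div_pos (Finset.sum_pos
    (fun j _ => gaussKernel_pos hh _) Finset.univ_nonempty) hn') Finset.univ_nonempty) hn'

lemma IsMEEOutput.empiricalPotential_le (hf : IsMEEOutput H h z f) (hh : 0 < h) (hn : n ≠ 0)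
    (hg : g ∈ H) : empiricalPotential h z g ≤ empiricalPotential h z f := by
  have hle := hf.2 g hg
  rw [empiricalRenyi_eq_neg_log, empiricalRenyi_eq_neg_log, neg_le_neg_iff] at hle
  exact (Real.log_le_log_iff (empiricalPotential_pos hh hn z g)
    (empiricalPotential_pos hh hn z f)).1 hle

variable [MeasurableSpace X] {ρ : Measure (X × ℝ)}

lemma IsMEEOutput.informationError_sub_le (hf : IsMEEOutput H h z f) (hh : 0 < h) (hn : n ≠ 0)
    (hg : g ∈ H) (ht : ∀ f ∈ H, |empiricalPotential h z f + informationError ρ h f| ≤ t) :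
    informationError ρ h f - informationError ρ h g ≤ 2 * t := by
  have hfz := (abs_le.1 (ht f hf.1)).2
  have hgz := (abs_le.1 (ht g hg)).1
  linarith [hf.empiricalPotential_le hh hn hg]

/-- Fixing one of the two observations turns the kernel into a function of the other observation,
shifted by the fixed residual. -/
lemma abs_empiricalPotential_add_informationError_le [IsProbabilityMeasure ρ] (hh : 0 < h)
    (hn : n ≠ 0) (hf : Measurable f) (hae : ∀ᵐ w ∂ρ, |w.2 - f w.1| ≤ R)
    (hz : ∀ i, |(z i).2 - f (z i).1| ≤ R)
    (ht : ∀ a ∈ Icc (-R) R, |sampleMean (fun w => gaussKernel h (w.2 - f w.1 - a)) z -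
      ∫ w, gaussKernel h (w.2 - f w.1 - a) ∂ρ| ≤ t) :
    |empiricalPotential h z f + informationError ρ h f| ≤ 2 * t := by
  have kernel_symm (w w' : X × ℝ) :
      gaussKernel h (residualDiff f (w, w')) = gaussKernel h (w'.2 - f w'.1 - (w.2 - f w.1)) := by
    rw [← gaussKernel_neg, residualDiff, neg_sub]
  have slice_le (w : X × ℝ) (hw : |w.2 - f w.1| ≤ R) :
      |sampleMean (fun w' => gaussKernel h (residualDiff f (w, w'))) z -
        ∫ w', gaussKernel h (residualDiff f (w, w')) ∂ρ| ≤ t := by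
    simp only [kernel_symm w]
    exact ht (w.2 - f w.1) (abs_le.1 hw)
  rw [informationError, ← sub_eq_add_neg]
  exact abs_sampleMean_sampleMean_sub_integral_le hn
    (K := fun w w' => gaussKernel h (residualDiff f (w, w')))
    (integrable_gaussKernel_residualDiff hh hf)
    (fun w => integrable_gaussKernel_comp hh ((measurable_residualDiff hf).comp
      measurable_prodMk_left)) kernel_symm hae hz slice_le

end EmpiricalPotential

section LearningRate

variable {X : Type*} [TopologicalSpace X] [TopologicalSpace.PseudoMetrizableSpace X]
  [MeasurableSpace X] [OpensMeasurableSpace X] {ρ : Measure (X × ℝ)} [IsProbabilityMeasure ρ]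
  {H : Set (X → ℝ)} {fstar : X → ℝ} {c s h m M R : ℝ}

theorem HasPolynomialEntropy.exists_measure_deviation_le (hH : HasPolynomialEntropy H c s)
    (hs : s < 2) (hsep : ∃ S : Set X, TopologicalSpace.IsSeparable S ∧ ∀ᵐ x ∂ρ.fst, x ∈ S)
    (hcont : ∀ f ∈ H, Continuous f) {l : ℝ≥0} {ψ : ℝ → ℝ} (hψ : LipschitzWith l ψ) {B : ℝ}
    (hB : ∀ t, |ψ t| ≤ B) (hR : 0 ≤ R) :
    ∃ κ > 0, ∀ n : ℕ, n ≠ 0 → ∀ t : ℝ, 0 ≤ t →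
      (Measure.pi fun _ : Fin n => ρ) {z | ∃ q : H × Icc (-R) R,
        t < |sampleMean (fun w => ψ (w.2 - q.1.1 w.1 - q.2)) z -
          ∫ w, ψ (w.2 - q.1.1 w.1 - q.2) ∂ρ|} ≤
      ENNReal.ofReal (2 * Real.exp (2 - t ^ 2 * n / (16 * κ))) := by
  obtain ⟨S, hS, hρS⟩ := hsep
  obtain ⟨κ, hκ, hsub⟩ := hH.exists_isRademacherSubgaussian hs hψ hB hR
  have hSuniv : TopologicalSpace.IsSeparable (S ×ˢ (univ : Set ℝ)) :=
    hS.prod (TopologicalSpace.IsSeparable.of_separableSpace univ)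
  have hρS' : ∀ᵐ w ∂ρ, w ∈ S ×ˢ (univ : Set ℝ) := by
    filter_upwards [ae_of_ae_map measurable_fst.aemeasurable hρS] with w hw using ⟨hw, mem_univ _⟩
  refine ⟨κ, hκ, fun n hn t ht => ?_⟩
  refine measure_exists_lt_abs_sampleMean_sub_integral_le hn hSuniv hρS' (fun q => ?_)
    (fun _ _ => hB _) hκ (fun z => hsub n hn z) ht
  exact hψ.continuous.comp
    ((continuous_snd.sub ((hcont q.1 q.1.2).comp continuous_fst)).sub continuous_const)

theorem exists_measure_lt_mul_adjustedErrorSq_le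
    (hsep : ∃ S : Set X, TopologicalSpace.IsSeparable S ∧ ∀ᵐ x ∂ρ.fst, x ∈ S)
    (hfstar : fstar ∈ H) (hcont : ∀ f ∈ H, Continuous f) (hM : ∀ f ∈ H, ∀ x, |f x| ≤ M)
    (hH : HasPolynomialEntropy H c s) (hs : s < 2) (hsymm : IsSymmetricAbout ρ fstar)
    (hm : ∀ᵐ z ∂ρ, |z.2 - fstar z.1| ≤ m) (hh : 0 < h) (hmh : 2 * m < h) :
    ∃ κ > 0, ∃ β > 0, ∀ n : ℕ, n ≠ 0 → ∀ fz : (Fin n → X × ℝ) → X → ℝ,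
      (∀ᵐ z ∂(Measure.pi fun _ : Fin n => ρ), IsMEEOutput H h z (fz z)) → ∀ t : ℝ, 0 ≤ t →
        (Measure.pi fun _ : Fin n => ρ) {z | 4 * t < β * adjustedErrorSq ρ.fst fstar (fz z)} ≤
          ENNReal.ofReal (2 * Real.exp (2 - t ^ 2 * n / (16 * κ))) := by
  have hmeas (f) (hf : f ∈ H) : Measurable f := (hcont f hf).measurable
  have dist_fstar_le (f) (hf : f ∈ H) (x : X) : |f x - fstar x| ≤ 2 * M :=
    (abs_sub _ _).trans (by linarith [hM f hf x, hM fstar hfstar x])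
  have residual_le (f) (hf : f ∈ H) (w : X × ℝ) (hw : |w.2 - fstar w.1| ≤ m) :
      |w.2 - f w.1| ≤ m + 2 * M := by
    have := abs_sub_le (w.2) (fstar w.1) (f w.1)
    linarith [abs_sub_comm (f w.1) (fstar w.1) ▸ dist_fstar_le f hf w.1]
  obtain ⟨w₀, hw₀⟩ := hm.exists
  obtain ⟨κ, hκ, hdev⟩ := hH.exists_measure_deviation_le hs hsep hcont
    (lipschitzWith_gaussKernel hh) (abs_gaussKernel_le hh)
    ((abs_nonneg _).trans (residual_le fstar hfstar w₀ hw₀))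
  obtain ⟨β, hβ, hcal⟩ := hsymm.exists_mul_adjustedErrorSq_le hm hh hmh (hmeas _ hfstar) (2 * M)
  refine ⟨κ, hκ, β, hβ, fun n hn fz hfz t ht => le_trans (measure_mono_ae ?_) (hdev n hn t ht)⟩
  have sample_noise_le : ∀ᵐ z ∂(Measure.pi fun _ : Fin n => ρ),
      ∀ i, |(z i).2 - fstar (z i).1| ≤ m :=
    ae_all_iff.2 fun i => (Measure.quasiMeasurePreserving_eval (fun _ => ρ) i).ae hm
  filter_upwards [hfz, sample_noise_le] with z hout hz
  refine fun hlt => by_contra fun hgood => hlt.not_ge ?_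
  have hgood (q : H × Icc (-(m + 2 * M)) (m + 2 * M)) := not_lt.1 fun hq => hgood ⟨q, hq⟩
  have potential_le (f) (hf : f ∈ H) :
      |empiricalPotential h z f + informationError ρ h f| ≤ 2 * t :=
    abs_empiricalPotential_add_informationError_le hh hn (hmeas f hf)
      (hm.mono fun w hw => residual_le f hf w hw) (fun i => residual_le f hf _ (hz i))
      fun a ha => hgood ⟨⟨f, hf⟩, ⟨a, ha⟩⟩
  calc β * adjustedErrorSq ρ.fst fstar (fz z)
    _ ≤ informationError ρ h (fz z) - informationError ρ h fstar :=
        hcal _ (hmeas _ hout.1) (dist_fstar_le _ hout.1)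
    _ ≤ 2 * (2 * t) := hout.informationError_sub_le hh hn hfstar potential_le
    _ = 4 * t := by ring

lemma two_mul_exp_two_sub_le {κ δ : ℝ} (hκ : 0 < κ) (hδ0 : 0 < δ) (hδ1 : δ < 1) {n : ℕ}
    (hn : n ≠ 0) :
    2 * Real.exp (2 - (√(80 * κ) * √(Real.log (2 / δ)) * (n : ℝ) ^ (-(1 / 2) : ℝ)) ^ 2 * n /
      (16 * κ)) ≤ δ := by
  have half_le_log : 1 / 2 ≤ Real.log (2 / δ) := by
    have : Real.log 2 ≤ Real.log (2 / δ) :=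
      Real.log_le_log two_pos ((le_div_iff₀ hδ0).2 (by linarith))
    linarith [Real.log_two_gt_d9]
  have rpow_sq : ((n : ℝ) ^ (-(1 / 2) : ℝ)) ^ 2 = (n : ℝ)⁻¹ := by
    rw [← Real.rpow_natCast, ← Real.rpow_mul n.cast_nonneg, ← Real.rpow_neg_one]
    norm_num
  have exponent_eq : (√(80 * κ) * √(Real.log (2 / δ)) * (n : ℝ) ^ (-(1 / 2) : ℝ)) ^ 2 * n /
      (16 * κ) = 5 * Real.log (2 / δ) := by
    rw [mul_pow, mul_pow, Real.sq_sqrt (by positivity), Real.sq_sqrt (by linarith), rpow_sq]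
    field_simp
    norm_num
  calc 2 * Real.exp (2 - (√(80 * κ) * √(Real.log (2 / δ)) * (n : ℝ) ^ (-(1 / 2) : ℝ)) ^ 2 * n /
          (16 * κ))
    _ ≤ 2 * Real.exp (-Real.log (2 / δ)) := by
        rw [exponent_eq]
        gcongr
        linarith
    _ = δ := by
        rw [Real.exp_neg, Real.exp_log (by positivity), inv_div]
        ring

theorem exists_measure_rate_lt_adjustedErrorSq_le
    (hsep : ∃ S : Set X, TopologicalSpace.IsSeparable S ∧ ∀ᵐ x ∂ρ.fst, x ∈ S)
    (hfstar : fstar ∈ H) (hcont : ∀ f ∈ H, Continuous f) (hM : ∀ f ∈ H, ∀ x, |f x| ≤ M)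
    (hH : HasPolynomialEntropy H c s) (hs : s < 2) (hsymm : IsSymmetricAbout ρ fstar)
    (hm : ∀ᵐ z ∂ρ, |z.2 - fstar z.1| ≤ m) (hh : 0 < h) (hmh : 2 * m < h) :
    ∃ C : ℝ, 0 < C ∧ ∀ n : ℕ, 1 ≤ n → ∀ fz : (Fin n → X × ℝ) → X → ℝ,
      (∀ᵐ z ∂(Measure.pi fun _ : Fin n => ρ), IsMEEOutput H h z (fz z)) →
      ∀ δ : ℝ, 0 < δ → δ < 1 →
        (Measure.pi fun _ : Fin n => ρ)
          {z | C * √(Real.log (2 / δ)) * (n : ℝ) ^ (-(1 / 2) : ℝ) <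
            adjustedErrorSq ρ.fst fstar (fz z)} ≤ ENNReal.ofReal δ := by
  obtain ⟨κ, hκ, β, hβ, hexcess⟩ :=
    exists_measure_lt_mul_adjustedErrorSq_le hsep hfstar hcont hM hH hs hsymm hm hh hmh
  refine ⟨4 * √(80 * κ) / β, by positivity, fun n hn fz hfz δ hδ0 hδ1 => ?_⟩
  have hn0 := Nat.one_le_iff_ne_zero.1 hn
  refine le_trans (measure_mono fun z hz => ?_) ((hexcess n hn0 fz hfz
    (√(80 * κ) * √(Real.log (2 / δ)) * (n : ℝ) ^ (-(1 / 2) : ℝ)) (by positivity)).trans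
    (ENNReal.ofReal_le_ofReal (two_mul_exp_two_sub_le hκ hδ0 hδ1 hn0)))
  refine (div_lt_iff₀' hβ).1 (lt_of_eq_of_lt ?_ hz)
  ring

end LearningRate

section ConvergenceInProbability

lemma tendsto_measure_lt_of_forall_rate {Ω : ℕ → Type*} [∀ n, MeasurableSpace (Ω n)]
    {μ : ∀ n, Measure (Ω n)} {D : ∀ n, Ω n → ℝ} {r : ℝ → ℕ → ℝ}
    (hr : ∀ δ, Tendsto (r δ) atTop (𝓝 0))
    (hD : ∀ δ, 0 < δ → δ < 1 → ∀ᶠ n in atTop, μ n {z | r δ n < D n z} ≤ ENNReal.ofReal δ)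
    {ε : ℝ} (hε : 0 < ε) : Tendsto (fun n => μ n {z | ε < D n z}) atTop (𝓝 0) := by
  refine ENNReal.tendsto_nhds_zero.2 fun η hη => ?_
  obtain ⟨δ, hδ0, hδη⟩ := ENNReal.lt_iff_exists_nnreal_btwn.1 (lt_min hη one_pos)
  have hδ1 : (δ : ℝ) < 1 := by exact_mod_cast hδη.trans_le (min_le_right _ _)
  filter_upwards [hD δ (by exact_mod_cast hδ0) hδ1, (hr δ).eventually_lt_const hε] with n hn hrn
  calc μ n {z | ε < D n z} ≤ μ n {z | r δ n < D n z} := measure_mono fun z hz => hrn.trans hz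
    _ ≤ ENNReal.ofReal δ := hn
    _ ≤ η := by
        rw [ENNReal.ofReal_coe_nnreal]
        exact hδη.le.trans (min_le_left _ _)

lemma tendsto_mul_rpow_neg_half_atTop (C : ℝ) :
    Tendsto (fun n : ℕ => C * (n : ℝ) ^ (-(1 / 2) : ℝ)) atTop (𝓝 0) := by
  simpa only [mul_zero, Function.comp_apply] using ((tendsto_rpow_neg_atTop one_half_pos).comp
    tendsto_natCast_atTop_atTop).const_mul C

end ConvergenceInProbability

end MEE

theorem mainTheorem6_general {X : Type*} [TopologicalSpace X]
    [TopologicalSpace.PseudoMetrizableSpace X] [MeasurableSpace X] [OpensMeasurableSpace X]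
    (ρ : Measure (X × ℝ)) [IsProbabilityMeasure ρ]
    (hsep : ∃ S : Set X, TopologicalSpace.IsSeparable S ∧ ∀ᵐ x ∂ρ.fst, x ∈ S)
    (fstar : X → ℝ) (H : Set (X → ℝ)) (c s m M : ℝ) (hfstar : fstar ∈ H)
    (hcont : ∀ f ∈ H, Continuous f) (hM : ∀ f ∈ H, ∀ x, |f x| ≤ M)
    (hH : MEE.HasPolynomialEntropy H c s) (hs : s < 2) (hsymm : MEE.IsSymmetricAbout ρ fstar)
    (hm : ∀ᵐ z ∂ρ, |z.2 - fstar z.1| ≤ m) (h : ℝ) (hmh : 2 * m < h) :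
    (∀ b : ℝ, IsMinOn (MEE.informationError ρ h) {f | Measurable f} (fun x => fstar x + b)) ∧
    (∀ fz : (n : ℕ) → (Fin n → X × ℝ) → X → ℝ,
      (∀ n, 1 ≤ n → ∀ᵐ z ∂(Measure.pi fun _ : Fin n => ρ), MEE.IsMEEOutput H h z (fz n z)) →
      ∀ ε : ℝ, 0 < ε →
        Tendsto (fun n : ℕ => (Measure.pi fun _ : Fin n => ρ)
          {z | ε < MEE.adjustedErrorSq ρ.fst fstar (fz n z)}) atTop (𝓝 0)) ∧
    (∃ C : ℝ, 0 < C ∧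
      ∀ n : ℕ, 1 ≤ n → ∀ fz : (Fin n → X × ℝ) → X → ℝ,
        (∀ᵐ z ∂(Measure.pi fun _ : Fin n => ρ), MEE.IsMEEOutput H h z (fz z)) →
        ∀ δ : ℝ, 0 < δ → δ < 1 →
          (Measure.pi fun _ : Fin n => ρ)
            {z | C * √(Real.log (2 / δ)) * (n : ℝ) ^ (-(1 / 2) : ℝ) <
              MEE.adjustedErrorSq ρ.fst fstar (fz z)} ≤ ENNReal.ofReal δ) := by
  obtain ⟨w, hw⟩ := hm.exists
  have hh : 0 < h := by linarith [abs_nonneg (w.2 - fstar w.1)]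
  obtain ⟨C, hC, hrate⟩ :=
    MEE.exists_measure_rate_lt_adjustedErrorSq_le hsep hfstar hcont hM hH hs hsymm hm hh hmh
  refine ⟨fun b f hf => ?_, fun fz hfz ε hε => ?_, C, hC, hrate⟩
  · rw [mem_ofPred_eq, MEE.informationError_add_const]
    exact hsymm.isMinOn_informationError hm hh hmh.le (hcont _ hfstar).measurable hf
  · refine MEE.tendsto_measure_lt_of_forall_rate
      (fun δ => MEE.tendsto_mul_rpow_neg_half_atTop (C * √(Real.log (2 / δ))))
      (fun δ hδ0 hδ1 => ?_) hε
    filter_upwards [eventually_ge_atTop 1] with n hn using hrate n hn _ (hfz n hn) δ hδ0 hδ1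

/-- `ρ` is the law of `(X, Y)`, `fstar` the regression function, `p x` the density of the noise given
`X = x`; the sample `z` of size `n` has law `ρⁿ`, and `fz` gives an MEE estimator on it. -/
theorem mainTheorem6 {X : Type*} [MetricSpace X] [MeasurableSpace X] [BorelSpace X]
    (ρ : Measure (X × ℝ)) [IsProbabilityMeasure ρ]
    (hsep : ∃ S : Set X, TopologicalSpace.IsSeparable S ∧ ∀ᵐ x ∂ρ.fst, x ∈ S)
    (fstar : X → ℝ) (p : X → ℝ → ℝ) (H : Set (X → ℝ)) (M Mt : ℝ) (hM : 0 < M)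
    (hmodel : MEE.ModelAdmissible ρ fstar p M)
    (hH : MEE.HypothesisAdmissible ρ fstar H M)
    (hP2 : MEE.SymmetricBoundedNoise p Mt)
    (h : ℝ) (hh : 4 * M + 2 * Mt < h) :
    (∀ b : ℝ, IsMinOn (MEE.informationError ρ h) {f | Measurable f} (fun x => fstar x + b)) ∧
    (∀ fz : (n : ℕ) → (Fin n → X × ℝ) → X → ℝ,
      (∀ n, 1 ≤ n → ∀ᵐ z ∂(Measure.pi fun _ : Fin n => ρ), MEE.IsMEEOutput H h z (fz n z)) →
      ∀ ε : ℝ, 0 < ε →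
        Tendsto (fun n : ℕ => (Measure.pi fun _ : Fin n => ρ)
          {z | ε < MEE.adjustedErrorSq ρ.fst fstar (fz n z)}) atTop (𝓝 0)) ∧
    (∃ C : ℝ, 0 < C ∧
      ∀ n : ℕ, 1 ≤ n → ∀ fz : (Fin n → X × ℝ) → X → ℝ,
        (∀ᵐ z ∂(Measure.pi fun _ : Fin n => ρ), MEE.IsMEEOutput H h z (fz z)) →
        ∀ δ : ℝ, 0 < δ → δ < 1 →
          (Measure.pi fun _ : Fin n => ρ)
            {z | C * √(Real.log (2 / δ)) * (n : ℝ) ^ (-(1 / 2) : ℝ) <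
              MEE.adjustedErrorSq ρ.fst fstar (fz z)} ≤ ENNReal.ofReal δ) := by
  obtain ⟨c, s, -, -, hs, hcovering⟩ := hH.covering
  exact mainTheorem6_general ρ hsep fstar H c s Mt M hH.fstar_mem hH.continuous hH.bounded
    hcovering hs (hmodel.density.isSymmetricAbout hmodel.measurable_fstar hP2.2.1)
    (hmodel.density.ae_abs_sub_le hmodel.measurable_fstar hP2.2.2) h (by linarith)
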